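/- Let $\mathcal A$ be a finite alphabet and let $\vartheta$ be a random substitution on $\mathcal A$: each letter $a$ has finitely many possible images $w^{(a,1)},\dots,w^{(a,k_a)}$ ($k_a\ge 1$), which are non-empty words over $\mathcal A$, and $\vartheta$ acts on words by replacing all letters independently. A choice of non-degenerate probability vectors is a family $\boldsymbol p=(\boldsymbol p_a)_{a\in\mathcal A}$ with $\boldsymbol p_a=(p_{a1},\dots,p_{ak_a})$, all $p_{aj}>0$ and $\sum_j p_{aj}=1$. Assume that $\vartheta$ is primitive (for some $k$, every letter occurs in some realisation of $\vartheta^k(b)$, for every letter $b$). A word is legal if it is a subword of a realisation of $\vartheta^k(a)$ for some $k$ and some letter $a$. Let $X_\vartheta\subseteq\mathcal A^{\mathbb Z}$ be the set of bi-infinite sequences all of whose finite subwords are legal, with the shift $S(w)_i=w_{i+1}$, and assume that $X_\vartheta\ne\emptyset$. For $\ell\ge1$, the induced random substitution $\vartheta_\ell$ acts on the alphabet of legal words of length $\ell$: if a legal word $w=w_0\cdots w_{\ell-1}$ has the realisation $v=v_0v_1\cdots$ of $\vartheta(w)$, obtained by independent choices of images of the letters $w_i$, then, with the probability of these choices, $w$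 is mapped to the sequence of words $v_{[k,k+\ell-1]}$, $0\le k\le m-1$, where $m$ is the length of the image chosen for $w_0$. Let $M_\ell=M_\ell(\boldsymbol p)$ be its matrix, whose $(u,w)$ entry is the expected number of occurrences of the letter $u$ in $\vartheta_\ell(w)$. Then for all non-degenerate $\boldsymbol p$ and all $\ell\ge1$ the matrix $M_\ell(\boldsymbol p)$ has exactly one positive right eigenvector $\boldsymbol R_\ell=\boldsymbol R_\ell(\boldsymbol p)$ with $\|\boldsymbol R_\ell\|_1=1$ for its largest real eigenvalue, which is positive; and there is exactly one Borel measure $\mu=\mu_{\boldsymbol p}$ on $X_\vartheta$ with $$\mu(\{x\in X_\vartheta : x_{[k,k+\ell-1]}=v\})=\boldsymbol R_\ell(v)$$ for all $\ell\ge1$, all legal words $v$ of length $\ell$ and all $k\in\mathbb Z$. Moreover: (a) If $(X_\vartheta,S)$ is uniquely ergodic (that is, has exactly one $S$-invariant Borel probability measure), then for every $\ell\ge1$ the vector $\boldsymbol R_\ell(\boldsymbol p)$ is the same for all non-degenerate $\boldsymbol p$. (b) If $\mu_{\boldsymbol p}$ is ergodic for $S$ for some non-degenerate $\boldsymbol p$,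 then $(X_\vartheta,S)$ is uniquely ergodic if and only if for every $\ell\ge1$ the vector $\boldsymbol R_\ell(\boldsymbol p')$ is the same for all non-degenerate $\boldsymbol p'$. -/

import Mathlib

open MeasureTheory

universe u v

/-- A random substitution on the alphabet `A` without its probability vectors: every letter `a` has
the finitely many possible images `word a q`, `q : Idx a`, which are nonempty words. -/
structure RandomSubstitution (A : Type u) where
  /-- the indices of the possible images of a letter -/
  Idx : A → Type v
  fintypeIdx : ∀ a, Fintype (Idx a)
  nonemptyIdx : ∀ a, Nonempty (Idx a)
  /-- the possible images of a letter -/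
  word : ∀ a, Idx a → List A
  word_ne_nil : ∀ a q, word a q ≠ []

namespace RandomSubstitution

instance {A : Type u} (θ : RandomSubstitution.{u, v} A) (a : A) : Fintype (θ.Idx a) :=
  θ.fintypeIdx a

instance {A : Type u} (θ : RandomSubstitution.{u, v} A) (a : A) : Nonempty (θ.Idx a) :=
  θ.nonemptyIdx a

/-- A family of real weights on the images of the letters: `p a q` is the weight of `θ.word a q`. -/
abbrev Weights {A : Type u} (θ : RandomSubstitution.{u, v} A) : Type (max u v) :=
  ∀ a, θ.Idx a → ℝ

/-- Every `p a` is a probability vector, and no probability vanishes. -/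
def IsNondegenerateProb {A : Type u} (θ : RandomSubstitution.{u, v} A) (p : θ.Weights) : Prop :=
  (∀ a, p a ∈ stdSimplex ℝ (θ.Idx a)) ∧ ∀ a q, p a q ≠ 0

/-- The random substitution matrix: the entry `(i, j)` is the expected number of occurrences of the
letter `i` in the random image of the letter `j`. -/
noncomputable def substMatrix {A : Type u} [DecidableEq A] (θ : RandomSubstitution.{u, v} A)
    (p : θ.Weights) : Matrix A A ℝ :=
  Matrix.of fun i j => ∑ q, p j q * ((θ.word j q).count i : ℝ)

/-- `θ.IsImage x y`: the word `y` is a realisation of `θ(x)`; every letter of `x` is replaced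
independently by one of its images. -/
inductive IsImage {A : Type u} (θ : RandomSubstitution.{u, v} A) : List A → List A → Prop
  | nil : IsImage θ [] []
  | cons (a : A) (q : θ.Idx a) {x y : List A} (h : IsImage θ x y) :
      IsImage θ (a :: x) (θ.word a q ++ y)

/-- `θ.IsRealisation k x y`: the word `y` is a realisation of `θ^k(x)`. -/
def IsRealisation {A : Type u} (θ : RandomSubstitution.{u, v} A) : ℕ → List A → List A → Prop
  | 0, x, y => y = x
  | k + 1, x, y => ∃ z, θ.IsRealisation k x z ∧ θ.IsImage z y

/-- Some power `θ^k` produces every letter from every letter. -/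
def IsPrimitive {A : Type u} (θ : RandomSubstitution.{u, v} A) : Prop :=
  ∃ k : ℕ, ∀ a b : A, ∃ y, θ.IsRealisation k [b] y ∧ a ∈ y

/-- A word is legal if it is a subword of a realisation of `θ^k(a)` for some `k` and some letter
`a`. -/
def Legal {A : Type u} (θ : RandomSubstitution.{u, v} A) (x : List A) : Prop :=
  ∃ (k : ℕ) (a : A) (y : List A), θ.IsRealisation k [a] y ∧ x <:+: y

/-- The random substitution subshift: all bi-infinite sequences whose finite subwords are legal. -/
def subshift {A : Type u} (θ : RandomSubstitution.{u, v} A) : Set (ℤ → A) :=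
  {w | ∀ (k : ℤ) (n : ℕ), θ.Legal (List.ofFn fun j : Fin n => w (k + (j : ℤ)))}

/-- The shift `S(w)_i = w_{i+1}` on the subshift. -/
def shift {A : Type u} (θ : RandomSubstitution.{u, v} A) (w : θ.subshift) : θ.subshift :=
  ⟨fun i => w.1 (i + 1), fun k n => by
    have h := w.2 (k + 1) n
    have e : (fun j : Fin n => w.1 (k + (j : ℤ) + 1)) = fun j : Fin n => w.1 (k + 1 + (j : ℤ)) := by
      funext j
      rw [add_right_comm]
    rw [e]
    exact h⟩

/-- The legal words of length `ℓ`, which form the alphabet of the induced substitution. -/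
abbrev LegalWord {A : Type u} (θ : RandomSubstitution.{u, v} A) (ℓ : ℕ) : Type u :=
  {x : Fin ℓ → A // θ.Legal (List.ofFn x)}

noncomputable instance {A : Type u} [Finite A] (θ : RandomSubstitution.{u, v} A) (ℓ : ℕ) :
    Fintype (θ.LegalWord ℓ) :=
  Fintype.ofFinite _

/-- The realisation of `θ(x)` in which the letter `x i` is replaced by its image number `c i`. -/
def wordImage {A : Type u} (θ : RandomSubstitution.{u, v} A) {ℓ : ℕ} (x : Fin ℓ → A)
    (c : ∀ i, θ.Idx (x i)) : List A :=
  (List.ofFn fun i => θ.word (x i) (c i)).flatten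

theorem isImage_wordImage {A : Type u} (θ : RandomSubstitution.{u, v} A) {ℓ : ℕ} (x : Fin ℓ → A)
    (c : ∀ i, θ.Idx (x i)) : θ.IsImage (List.ofFn x) (θ.wordImage x c) := by
  induction ℓ with
  | zero => simpa [wordImage] using IsImage.nil
  | succ n ih =>
    have h := ih (fun i => x i.succ) (fun i => c i.succ)
    simpa [wordImage, List.ofFn_succ] using IsImage.cons (x 0) (c 0) h

theorem le_length_wordImage {A : Type u} (θ : RandomSubstitution.{u, v} A) {ℓ : ℕ} (x : Fin ℓ → A)
    (c : ∀ i, θ.Idx (x i)) : ℓ ≤ (θ.wordImage x c).length := by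
  induction ℓ with
  | zero => simp
  | succ n ih =>
    have h := ih (fun i => x i.succ) (fun i => c i.succ)
    have h0 := List.length_pos_of_ne_nil (θ.word_ne_nil (x 0) (c 0))
    simp only [wordImage, List.ofFn_succ, List.flatten_cons, List.length_append] at h ⊢
    omega

theorem window_lt {A : Type u} (θ : RandomSubstitution.{u, v} A) {ℓ : ℕ} [NeZero ℓ] (x : Fin ℓ → A)
    (c : ∀ i, θ.Idx (x i)) (k : Fin (θ.word (x 0) (c 0)).length) (j : Fin ℓ) :
    (k : ℕ) + j < (θ.wordImage x c).length := by
  obtain _ | n := ℓ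
  · exact j.elim0
  · have h := θ.le_length_wordImage (fun i => x i.succ) (fun i => c i.succ)
    have hk := k.2
    have hj := j.2
    simp only [wordImage, List.ofFn_succ, List.flatten_cons, List.length_append] at h ⊢
    omega

theorem exists_isImage {A : Type u} (θ : RandomSubstitution.{u, v} A) (x : List A) :
    ∃ y, θ.IsImage x y := by
  induction x with
  | nil => exact ⟨_, IsImage.nil⟩
  | cons a x ih =>
    obtain ⟨y, hy⟩ := ih
    exact ⟨_, IsImage.cons a (Classical.arbitrary _) hy⟩

theorem IsImage.append {A : Type u} {θ : RandomSubstitution.{u, v} A} {x y x' y' : List A}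
    (h : θ.IsImage x y) (h' : θ.IsImage x' y') : θ.IsImage (x ++ x') (y ++ y') := by
  induction h with
  | nil => simpa using h'
  | cons a q _ ih => simpa using IsImage.cons a q ih

theorem Legal.of_isImage {A : Type u} {θ : RandomSubstitution.{u, v} A} {x y z : List A}
    (hx : θ.Legal x) (hy : θ.IsImage x y) (hz : z <:+: y) : θ.Legal z := by
  obtain ⟨k, a, t, ht, s₁, s₂, rfl⟩ := hx
  obtain ⟨r₁, hr₁⟩ := θ.exists_isImage s₁
  obtain ⟨r₂, hr₂⟩ := θ.exists_isImage s₂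
  exact ⟨k + 1, a, _, ⟨_, ht, (hr₁.append hy).append hr₂⟩, hz.trans ⟨r₁, r₂, rfl⟩⟩

/-- The subword of length `ℓ` at position `k` of the realisation `θ.wordImage x c`, where `k` is a
position inside the image of the first letter of `x`. -/
def window {A : Type u} (θ : RandomSubstitution.{u, v} A) {ℓ : ℕ} [NeZero ℓ] (x : Fin ℓ → A)
    (c : ∀ i, θ.Idx (x i)) (k : Fin (θ.word (x 0) (c 0)).length) : Fin ℓ → A :=
  fun j => (θ.wordImage x c)[(k : ℕ) + j]'(θ.window_lt x c k j)

theorem legal_window {A : Type u} (θ : RandomSubstitution.{u, v} A) {ℓ : ℕ} [NeZero ℓ]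
    (x : θ.LegalWord ℓ) (c : ∀ i, θ.Idx (x.1 i)) (k : Fin (θ.word (x.1 0) (c 0)).length) :
    θ.Legal (List.ofFn (θ.window x.1 c k)) := by
  refine x.2.of_isImage (θ.isImage_wordImage x.1 c) ?_
  have e : List.ofFn (θ.window x.1 c k) = ((θ.wordImage x.1 c).drop k).take ℓ := by
    apply List.ext_getElem
    · have h := θ.window_lt x.1 c k ⟨ℓ - 1, Nat.sub_lt (NeZero.pos ℓ) one_pos⟩
      simp only at h
      have h1 := NeZero.pos ℓ
      simp only [List.length_ofFn, List.length_take, List.length_drop]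
      omega
    · intro i h1 h2
      simp [window]
  rw [e]
  exact (List.take_prefix _ _).isInfix.trans (List.drop_suffix _ _).isInfix

/-- The induced random substitution on the legal words of length `ℓ`. For every choice `c` of images
of the letters of `x`, with resulting realisation `y` of `θ(x)`, the word `x` is mapped to the
sequence of the words `y_{[k, k + ℓ - 1]}`, where `k` runs through the positions inside the image of
the first letter of `x`. -/
def induced {A : Type u} (θ : RandomSubstitution.{u, v} A) (ℓ : ℕ) [NeZero ℓ] :
    RandomSubstitution.{u, v} (θ.LegalWord ℓ) where
  Idx x := ∀ i, θ.Idx (x.1 i)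
  fintypeIdx _ := inferInstance
  nonemptyIdx _ := inferInstance
  word x c := List.ofFn fun k : Fin (θ.word (x.1 0) (c 0)).length =>
    ⟨θ.window x.1 c k, θ.legal_window x c k⟩
  word_ne_nil x c h := θ.word_ne_nil (x.1 0) (c 0)
    (List.length_eq_zero_iff.1 (List.ofFn_eq_nil_iff.1 h))

/-- The probabilities of the induced random substitution: letters are substituted independently. -/
def inducedWeights {A : Type u} (θ : RandomSubstitution.{u, v} A) (p : θ.Weights) (ℓ : ℕ)
    [NeZero ℓ] : (θ.induced ℓ).Weights :=
  fun x c => ∏ i : Fin ℓ, p (x.1 i) (c i)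

/-- The induced random substitution matrix `M_ℓ`. -/
noncomputable def inducedMatrix {A : Type u} [DecidableEq A] (θ : RandomSubstitution.{u, v} A)
    (p : θ.Weights) (ℓ : ℕ) [NeZero ℓ] : Matrix (θ.LegalWord ℓ) (θ.LegalWord ℓ) ℝ :=
  (θ.induced ℓ).substMatrix (θ.inducedWeights p ℓ)

end RandomSubstitution

/-- `R` is a normalised right Perron–Frobenius eigenvector of `M`: a positive right eigenvector with
`ℓ¹`-norm `1` for an eigenvalue that is positive and the largest of all real eigenvalues. -/
def IsPerronVector {ι : Type u} [Fintype ι] [DecidableEq ι] (M : Matrix ι ι ℝ) (R : ι → ℝ) : Prop :=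
  (∀ i, 0 < R i) ∧ ∑ i, R i = 1 ∧
    ∃ r : ℝ, 0 < r ∧ IsGreatest {t : ℝ | Module.End.HasEigenvalue (Matrix.toLin' M) t} r ∧
      Matrix.mulVec M R = r • R

/-- A transformation is uniquely ergodic if it has exactly one invariant probability measure. -/
def UniquelyErgodic {X : Type u} [MeasurableSpace X] (T : X → X) : Prop :=
  ∃! μ : Measure X, IsProbabilityMeasure μ ∧ MeasurePreserving T μ μ

namespace RandomSubstitution

/-- The normalised right Perron–Frobenius eigenvector `R_ℓ` of the matrix `M_ℓ`. -/
noncomputable def perronVector {A : Type u} [Finite A] [DecidableEq A]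
    (θ : RandomSubstitution.{u, v} A) (p : θ.Weights) (ℓ : ℕ) [NeZero ℓ] : θ.LegalWord ℓ → ℝ :=
  Classical.epsilon (IsPerronVector (θ.inducedMatrix p ℓ))

/-- The cylinder set of all sequences in the subshift that show the word `x` at position `k`. -/
def cylinder {A : Type u} (θ : RandomSubstitution.{u, v} A) {ℓ : ℕ} (k : ℤ) (x : Fin ℓ → A) :
    Set θ.subshift :=
  {w | ∀ j : Fin ℓ, w.1 (k + (j : ℤ)) = x j}

/-- The measure `μ` gives every cylinder set of a legal word `x` of length `ℓ` the mass `R_ℓ(x)`. -/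
def IsFrequencyMeasure {A : Type u} [Finite A] [DecidableEq A] [MeasurableSpace A]
    (θ : RandomSubstitution.{u, v} A) (p : θ.Weights) (μ : Measure θ.subshift) : Prop :=
  ∀ (ℓ : ℕ) [NeZero ℓ] (x : θ.LegalWord ℓ) (k : ℤ),
    μ (θ.cylinder k x.1) = ENNReal.ofReal (θ.perronVector p ℓ x)

/-- The measure on the subshift that is determined by the Perron–Frobenius eigenvectors. -/
noncomputable def frequencyMeasure {A : Type u} [Finite A] [DecidableEq A] [MeasurableSpace A]
    (θ : RandomSubstitution.{u, v} A) (p : θ.Weights) : Measure θ.subshift :=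
  Classical.epsilon (θ.IsFrequencyMeasure p)

/-- For every `ℓ ≥ 1`, the vector `R_ℓ` is the same for all non-degenerate choices of the
probability vectors. -/
def PerronVectorsIndependent {A : Type u} [Finite A] [DecidableEq A]
    (θ : RandomSubstitution.{u, v} A) : Prop :=
  ∀ (ℓ : ℕ) [NeZero ℓ] (p p' : θ.Weights), θ.IsNondegenerateProb p → θ.IsNondegenerateProb p' →
    θ.perronVector p ℓ = θ.perronVector p' ℓ

end RandomSubstitution

set_option linter.unusedSectionVars false

namespace Matrix

variable {ι : Type*} [Fintype ι] [DecidableEq ι] {M : Matrix ι ι ℝ}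

theorem IsPrimitive.transpose (hM : M.IsPrimitive) : Mᵀ.IsPrimitive := by
  obtain ⟨h0, k, hk, h⟩ := hM
  exact ⟨fun i j => h0 j i, k, hk, fun i j => by rw [← transpose_pow]; exact h j i⟩

theorem pow_mulVec_eq {x : ι → ℝ} {t : ℝ} (h : M *ᵥ x = t • x) (n : ℕ) :
    (M ^ n) *ᵥ x = t ^ n • x := by
  induction n with
  | zero => simp
  | succ n ih => rw [pow_succ, ← mulVec_mulVec, h, mulVec_smul, ih, smul_smul, pow_succ, mul_comm]

theorem vecMul_pow_eq {x : ι → ℝ} {t : ℝ} (h : x ᵥ* M = t • x) (n : ℕ) :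
    x ᵥ* (M ^ n) = t ^ n • x := by
  induction n with
  | zero => simp
  | succ n ih => rw [pow_succ, ← vecMul_vecMul, ih, smul_vecMul, h, smul_smul, pow_succ]

theorem mulVec_pos {x : ι → ℝ} (hM : ∀ i j, 0 < M i j) (hx : ∀ i, 0 ≤ x i) (hx0 : x ≠ 0) (i : ι) :
    0 < (M *ᵥ x) i := by
  obtain ⟨j, hj⟩ := Function.ne_iff.1 hx0
  refine Finset.sum_pos' (fun k _ => mul_nonneg (hM i k).le (hx k)) ⟨j, Finset.mem_univ j, ?_⟩
  exact mul_pos (hM i j) (lt_of_le_of_ne (hx j) (Ne.symm hj))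

/-- The pairs `(x, t)` of a probability vector `x` and a number `t ≥ 0` with `t x ≤ M x`. -/
def subinvariantPairs (M : Matrix ι ι ℝ) : Set ((ι → ℝ) × ℝ) :=
  {z | z.1 ∈ stdSimplex ℝ ι ∧ 0 ≤ z.2 ∧ ∀ i, z.2 * z.1 i ≤ (M *ᵥ z.1) i}

theorem isCompact_subinvariantPairs (hM : ∀ i j, 0 ≤ M i j) :
    IsCompact (subinvariantPairs M) := by
  have hK : IsCompact ((stdSimplex ℝ ι) ×ˢ (Set.Icc 0 (∑ i, ∑ j, M i j))) :=
    (isCompact_stdSimplex ℝ ι).prod isCompact_Icc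
  refine hK.of_isClosed_subset ?_ ?_
  · refine (isClosed_stdSimplex ℝ ι |>.preimage continuous_fst).inter
      ((isClosed_Ici.preimage continuous_snd).inter ?_)
    have e : {z : (ι → ℝ) × ℝ | ∀ i, z.2 * z.1 i ≤ (M *ᵥ z.1) i} =
        ⋂ i, {z : (ι → ℝ) × ℝ | z.2 * z.1 i ≤ (M *ᵥ z.1) i} := by ext; simp
    change IsClosed {z : (ι → ℝ) × ℝ | ∀ i, z.2 * z.1 i ≤ (M *ᵥ z.1) i}
    rw [e]
    refine isClosed_iInter fun i => isClosed_le (by fun_prop) ?_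
    simp only [mulVec, dotProduct]
    fun_prop
  · rintro ⟨x, t⟩ ⟨hx, ht, h⟩
    refine ⟨hx, ht, ?_⟩
    simp only at h ⊢
    calc t = ∑ i, t * x i := by rw [← Finset.mul_sum, hx.2, mul_one]
      _ ≤ ∑ i, (M *ᵥ x) i := Finset.sum_le_sum fun i _ => h i
      _ ≤ ∑ i, ∑ j, M i j := by
        refine Finset.sum_le_sum fun i _ => Finset.sum_le_sum fun j _ => ?_
        exact mul_le_of_le_one_right (hM i j)
          (hx.2 ▸ Finset.single_le_sum (fun k _ => hx.1 k) (Finset.mem_univ j))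

/-- Existence part of the Perron–Frobenius theorem for primitive matrices. -/
theorem IsPrimitive.exists_pos_eigenvector [Nonempty ι] (hM : M.IsPrimitive) :
    ∃ (x : ι → ℝ) (t : ℝ), (∀ i, 0 < x i) ∧ ∑ i, x i = 1 ∧ 0 < t ∧ M *ᵥ x = t • x := by
  obtain ⟨h0, N, hN0, hN⟩ := hM
  obtain ⟨i₀⟩ := ‹Nonempty ι›
  have hne : (subinvariantPairs M).Nonempty := by
    refine ⟨(Pi.single i₀ 1, 0), single_mem_stdSimplex ℝ i₀, le_rfl, fun i => ?_⟩
    simpa using h0 i i₀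
  obtain ⟨⟨x, t⟩, ⟨hx, ht, h⟩, hmax⟩ :=
    (isCompact_subinvariantPairs h0).exists_isMaxOn hne continuous_snd.continuousOn
  simp only at hx ht h
  have hx0 : x ≠ 0 := by
    rintro rfl
    simpa using hx.2
  have hy := mulVec_pos hN hx.1 hx0
  set y := (M ^ N) *ᵥ x with hy_def
  have heq : M *ᵥ x = t • x := by
    by_contra hne
    have hz : M *ᵥ x - t • x ≠ 0 := sub_ne_zero.2 hne
    have hz' := mulVec_pos hN (x := M *ᵥ x - t • x)
      (fun i => by simpa using h i) hz
    have hcomm : (M ^ N) *ᵥ (M *ᵥ x) = M *ᵥ y := by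
      rw [hy_def, mulVec_mulVec, mulVec_mulVec, ← pow_succ, ← pow_succ']
    rw [mulVec_sub, mulVec_smul, hcomm, ← hy_def] at hz'
    obtain ⟨j, -, hj⟩ := Finset.exists_min_image Finset.univ (fun i => (M *ᵥ y) i / y i)
      ⟨i₀, Finset.mem_univ _⟩
    have hlt : t < (M *ᵥ y) j / y j := by
      rw [lt_div_iff₀ (hy j)]
      have := hz' j
      simp only [Pi.sub_apply, Pi.smul_apply, smul_eq_mul] at this
      linarith
    have hs : 0 < ∑ i, y i := Finset.sum_pos (fun i _ => hy i) ⟨i₀, Finset.mem_univ _⟩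
    have hmem : ((∑ i, y i)⁻¹ • y, (M *ᵥ y) j / y j) ∈ subinvariantPairs M := by
      refine ⟨⟨fun i => ?_, ?_⟩, (ht.trans hlt.le), fun i => ?_⟩
      · exact mul_nonneg (inv_nonneg.2 hs.le) (hy i).le
      · simp only [Pi.smul_apply, smul_eq_mul, ← Finset.mul_sum]
        exact inv_mul_cancel₀ hs.ne'
      · simp only [mulVec_smul, Pi.smul_apply, smul_eq_mul]
        rw [mul_left_comm]
        refine mul_le_mul_of_nonneg_left ?_ (inv_nonneg.2 hs.le)
        rw [← le_div_iff₀ (hy i)]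
        exact hj i (Finset.mem_univ i)
    have := hmax hmem
    exact absurd this (not_le.2 hlt)
  have hpow : ∀ i, 0 < t ^ N * x i := fun i => by
    have := hy i
    rwa [hy_def, pow_mulVec_eq heq] at this
  have htpos : 0 < t := by
    refine lt_of_le_of_ne ht fun h => ?_
    have := hpow i₀
    rw [← h, zero_pow hN0.ne', zero_mul] at this
    exact this.false
  exact ⟨x, t, fun i => (mul_pos_iff_of_pos_left (pow_pos htpos N)).1 (hpow i), hx.2, htpos, heq⟩

/-- Powers of a primitive matrix contract the vectors that are orthogonal to its right eigenvector
faster than the powers of the eigenvalue grow. -/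
theorem IsPrimitive.exists_abs_vecMul_pow_le (hM : M.IsPrimitive) {L R : ι → ℝ} {r : ℝ}
    (hr : 0 < r) (hL : ∀ i, 0 < L i) (hR : ∀ i, 0 < R i) (hLM : L ᵥ* M = r • L)
    (hMR : M *ᵥ R = r • R) {f : ι → ℝ} (hf : f ⬝ᵥ R = 0) {ε : ℝ} (hε : 0 < ε) :
    ∃ k : ℕ, ∀ j, |(f ᵥ* (M ^ k)) j| ≤ ε * r ^ k * L j := by
  cases isEmpty_or_nonempty ι with
  | inl h => exact ⟨0, fun j => isEmptyElim j⟩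
  | inr hι =>
  obtain ⟨h0, N, -, hN⟩ := hM
  have hrN := pow_pos hr N
  obtain ⟨δ, hδ, hδle⟩ : ∃ δ > 0, ∀ i j, δ * (R i * L j) ≤ (M ^ N) i j := by
    obtain ⟨z, -, hz⟩ := Finset.exists_min_image (Finset.univ : Finset (ι × ι))
      (fun z => (M ^ N) z.1 z.2 / (R z.1 * L z.2)) Finset.univ_nonempty
    refine ⟨_, div_pos (hN z.1 z.2) (mul_pos (hR z.1) (hL z.2)), fun i j => ?_⟩
    rw [← le_div_iff₀ (mul_pos (hR _) (hL _))]
    exact hz (i, j) (Finset.mem_univ _)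
  obtain ⟨β, hβ0, hβ⟩ : ∃ β ≥ 0, ∀ j, |f j| ≤ β * L j := by
    refine ⟨∑ i, |f i| / L i, Finset.sum_nonneg fun i _ => div_nonneg (abs_nonneg _) (hL i).le,
      fun j => ?_⟩
    rw [← div_le_iff₀ (hL j)]
    exact Finset.single_le_sum (f := fun i => |f i| / L i)
      (fun i _ => div_nonneg (abs_nonneg _) (hL i).le) (Finset.mem_univ j)
  have hLN := vecMul_pow_eq hLM N
  have hRN := pow_mulVec_eq hMR N
  have hLR : 0 < L ⬝ᵥ R := Finset.sum_pos (fun i _ => mul_pos (hL i) (hR i)) Finset.univ_nonempty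
  set γ := r ^ N - δ * (L ⬝ᵥ R) with hγ
  have hγ0 : 0 ≤ γ := by
    obtain ⟨j⟩ := hι
    have h1 : (L ᵥ* (M ^ N)) j = r ^ N * L j := by rw [hLN]; rfl
    have h2 : δ * (L ⬝ᵥ R) * L j ≤ (L ᵥ* (M ^ N)) j := by
      simp only [vecMul, dotProduct, Finset.mul_sum, Finset.sum_mul]
      refine Finset.sum_le_sum fun i _ => ?_
      nlinarith [mul_le_mul_of_nonneg_left (hδle i j) (hL i).le]
    rw [h1] at h2
    nlinarith [le_of_mul_le_mul_right h2 (hL j)]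
  have hstep : ∀ n : ℕ, (f ᵥ* ((M ^ N) ^ n)) ⬝ᵥ R = 0 ∧
      ∀ j, |(f ᵥ* ((M ^ N) ^ n)) j| ≤ β * γ ^ n * L j := by
    intro n
    induction n with
    | zero => simpa [hf] using hβ
    | succ n ih =>
      obtain ⟨ih1, ih2⟩ := ih
      set g := f ᵥ* ((M ^ N) ^ n)
      have e : f ᵥ* ((M ^ N) ^ (n + 1)) = g ᵥ* (M ^ N) := by rw [pow_succ, ← vecMul_vecMul]
      rw [e]
      refine ⟨by rw [← dotProduct_mulVec, hRN, dotProduct_smul, ih1, smul_zero], fun j => ?_⟩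
      have e1 : (g ᵥ* (M ^ N)) j = ∑ i, g i * ((M ^ N) i j - δ * (R i * L j)) := by
        have : ∑ i, g i * (δ * (R i * L j)) = 0 := by
          have : ∑ i, g i * (δ * (R i * L j)) = δ * L j * (g ⬝ᵥ R) := by
            simp only [dotProduct, Finset.mul_sum]
            exact Finset.sum_congr rfl fun i _ => by ring
          rw [this, ih1, mul_zero]
        simp only [mul_sub, Finset.sum_sub_distrib, this, sub_zero]
        rfl
      have e2 : ∑ i, L i * ((M ^ N) i j - δ * (R i * L j)) = γ * L j := by
        have h1 : ∑ i, L i * (M ^ N) i j = r ^ N * L j := congrFun hLN j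
        have h2 : ∑ i, L i * (δ * (R i * L j)) = δ * (L ⬝ᵥ R) * L j := by
          simp only [dotProduct, Finset.mul_sum, Finset.sum_mul]
          exact Finset.sum_congr rfl fun i _ => by ring
        simp only [mul_sub, Finset.sum_sub_distrib, h1, h2]
        ring
      rw [e1]
      calc |∑ i, g i * ((M ^ N) i j - δ * (R i * L j))|
          ≤ ∑ i, |g i * ((M ^ N) i j - δ * (R i * L j))| := Finset.abs_sum_le_sum_abs _ _
        _ ≤ ∑ i, (β * γ ^ n) * (L i * ((M ^ N) i j - δ * (R i * L j))) := by
          refine Finset.sum_le_sum fun i _ => ?_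
          have h3 : 0 ≤ (M ^ N) i j - δ * (R i * L j) := sub_nonneg.2 (hδle i j)
          rw [abs_mul, abs_of_nonneg h3, ← mul_assoc (β * γ ^ n)]
          exact mul_le_mul_of_nonneg_right (ih2 i) h3
        _ = β * γ ^ (n + 1) * L j := by rw [← Finset.mul_sum, e2]; ring
  have hq : γ / r ^ N < 1 := by
    rw [div_lt_one hrN]
    nlinarith [mul_pos hδ hLR]
  obtain ⟨n, hn⟩ : ∃ n : ℕ, β * (γ / r ^ N) ^ n < ε := by
    have ht : Filter.Tendsto (fun n : ℕ => β * (γ / r ^ N) ^ n) Filter.atTop (nhds (β * 0)) :=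
      (tendsto_pow_atTop_nhds_zero_of_lt_one (div_nonneg hγ0 hrN.le) hq).const_mul β
    rw [mul_zero] at ht
    exact (ht.eventually (gt_mem_nhds hε)).exists
  refine ⟨N * n, fun j => ?_⟩
  rw [pow_mul M]
  refine ((hstep n).2 j).trans (mul_le_mul_of_nonneg_right ?_ (hL j).le)
  rw [div_pow, ← mul_div_assoc, div_lt_iff₀ (pow_pos hrN n)] at hn
  rw [pow_mul r]
  exact hn.le

theorem eq_of_dotProduct_eq_zero {x R : ι → ℝ} (hx : ∑ i, x i = 1) (hR : ∑ i, R i = 1)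
    (h : ∀ f : ι → ℝ, f ⬝ᵥ R = 0 → f ⬝ᵥ x = 0) : x = R := by
  funext i
  have h1 := h (Pi.single i 1 - fun _ => R i) (by
    rw [sub_dotProduct, single_dotProduct, one_mul]
    simp [dotProduct, ← Finset.mul_sum, hR])
  rw [sub_dotProduct, single_dotProduct, one_mul] at h1
  simp only [dotProduct, ← Finset.mul_sum, hx, mul_one] at h1
  linarith

theorem eigenvalue_eq_of_dotProduct_pos {L R : ι → ℝ} {r s : ℝ} (hLR : 0 < L ⬝ᵥ R)
    (hLM : L ᵥ* M = r • L) (hMR : M *ᵥ R = s • R) : s = r := by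
  have := dotProduct_mulVec L M R
  rw [hLM, hMR, dotProduct_smul, smul_dotProduct, smul_eq_mul, smul_eq_mul] at this
  exact mul_right_cancel₀ hLR.ne' this

/-- A nonnegative normalised eigenvector of a primitive matrix is the Perron–Frobenius vector. -/
theorem IsPrimitive.eq_of_mulVec_eq (hM : M.IsPrimitive) {L R x : ι → ℝ} {r s : ℝ} (hr : 0 < r)
    (hL : ∀ i, 0 < L i) (hR : ∀ i, 0 < R i) (hR1 : ∑ i, R i = 1) (hLM : L ᵥ* M = r • L)
    (hMR : M *ᵥ R = r • R) (hx : ∀ i, 0 ≤ x i) (hx1 : ∑ i, x i = 1) (hMx : M *ᵥ x = s • x) :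
    s = r ∧ x = R := by
  have hLx : 0 < L ⬝ᵥ x := by
    have hx0 : x ≠ 0 := by rintro rfl; simp at hx1
    obtain ⟨i, hi⟩ := Function.ne_iff.1 hx0
    exact Finset.sum_pos' (fun i _ => mul_nonneg (hL i).le (hx i))
      ⟨i, Finset.mem_univ i, mul_pos (hL i) (lt_of_le_of_ne (hx i) (Ne.symm hi))⟩
  have hsr : s = r := eigenvalue_eq_of_dotProduct_pos hLx hLM hMx
  subst hsr
  refine ⟨rfl, eq_of_dotProduct_eq_zero hx1 hR1 fun f hf => ?_⟩
  by_contra hne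
  have hpos : 0 < |f ⬝ᵥ x| := abs_pos.2 hne
  obtain ⟨k, hk⟩ := hM.exists_abs_vecMul_pow_le hr hL hR hLM hMR hf
    (ε := |f ⬝ᵥ x| / (2 * (L ⬝ᵥ x))) (by positivity)
  have e1 : (f ᵥ* (M ^ k)) ⬝ᵥ x = s ^ k * (f ⬝ᵥ x) := by
    rw [← dotProduct_mulVec, pow_mulVec_eq hMx, dotProduct_smul, smul_eq_mul]
  have e2 : |(f ᵥ* (M ^ k)) ⬝ᵥ x| ≤ |f ⬝ᵥ x| / (2 * (L ⬝ᵥ x)) * s ^ k * (L ⬝ᵥ x) := by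
    refine (Finset.abs_sum_le_sum_abs _ _).trans ?_
    have e3 : ∀ c : ℝ, c * (L ⬝ᵥ x) = ∑ i, c * (L i * x i) := fun c => Finset.mul_sum _ _ _
    rw [e3]
    refine Finset.sum_le_sum fun i _ => ?_
    rw [abs_mul, abs_of_nonneg (hx i), ← mul_assoc]
    exact mul_le_mul_of_nonneg_right (hk i) (hx i)
  rw [e1, abs_mul, abs_of_pos (pow_pos hr k)] at e2
  have e3 : |f ⬝ᵥ x| / (2 * (L ⬝ᵥ x)) * s ^ k * (L ⬝ᵥ x) = s ^ k * |f ⬝ᵥ x| / 2 := by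
    field_simp
  rw [e3] at e2
  nlinarith [mul_pos (pow_pos hr k) hpos]

theorem isGreatest_hasEigenvalue (hM : ∀ i j, 0 ≤ M i j) {L R : ι → ℝ} {r : ℝ}
    (hL : ∀ i, 0 < L i) (hR : R ≠ 0) (hLM : L ᵥ* M = r • L) (hMR : M *ᵥ R = r • R) :
    IsGreatest {t : ℝ | Module.End.HasEigenvalue (Matrix.toLin' M) t} r := by
  refine ⟨Module.End.hasEigenvalue_of_hasEigenvector (x := R)
    ⟨Module.End.mem_eigenspace_iff.2 (by simpa using hMR), hR⟩, fun t ht => ?_⟩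
  obtain ⟨x, hx, hx0⟩ := ht.exists_hasEigenvector
  have hMx : M *ᵥ x = t • x := by simpa using Module.End.mem_eigenspace_iff.1 hx
  have hpos : 0 < L ⬝ᵥ fun i => |x i| := by
    obtain ⟨i, hi⟩ := Function.ne_iff.1 hx0
    exact Finset.sum_pos' (fun i _ => mul_nonneg (hL i).le (abs_nonneg _))
      ⟨i, Finset.mem_univ i, mul_pos (hL i) (abs_pos.2 hi)⟩
  refine le_of_mul_le_mul_right ?_ hpos
  calc t * (L ⬝ᵥ fun i => |x i|) ≤ |t| * (L ⬝ᵥ fun i => |x i|) :=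
        mul_le_mul_of_nonneg_right (le_abs_self t) hpos.le
    _ = L ⬝ᵥ fun i => |(M *ᵥ x) i| := by
      simp only [hMx, Pi.smul_apply, smul_eq_mul, abs_mul, dotProduct, Finset.mul_sum]
      exact Finset.sum_congr rfl fun i _ => by ring
    _ ≤ L ⬝ᵥ (M *ᵥ fun i => |x i|) := by
      refine Finset.sum_le_sum fun i _ => mul_le_mul_of_nonneg_left ?_ (hL i).le
      refine (Finset.abs_sum_le_sum_abs _ _).trans (Finset.sum_le_sum fun j _ => ?_)
      rw [abs_mul, abs_of_nonneg (hM i j)]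
    _ = r * (L ⬝ᵥ fun i => |x i|) := by
      rw [dotProduct_mulVec, hLM, smul_dotProduct, smul_eq_mul]

end Matrix

theorem Matrix.IsPrimitive.existsUnique_isPerronVector {ι : Type u} [Fintype ι] [DecidableEq ι]
    [Nonempty ι] {M : Matrix ι ι ℝ} (hM : M.IsPrimitive) : ∃! R, IsPerronVector M R := by
  obtain ⟨R, r, hR, hR1, hr, hMR⟩ := hM.exists_pos_eigenvector
  obtain ⟨L, s, hL, -, -, hLM⟩ := hM.transpose.exists_pos_eigenvector
  rw [Matrix.mulVec_transpose] at hLM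
  have hLR : 0 < L ⬝ᵥ R := Finset.sum_pos (fun i _ => mul_pos (hL i) (hR i)) Finset.univ_nonempty
  obtain rfl : r = s := Matrix.eigenvalue_eq_of_dotProduct_pos hLR hLM hMR
  refine ⟨R, ⟨hR, hR1, r, hr, Matrix.isGreatest_hasEigenvalue hM.nonneg hL ?_ hLM hMR, hMR⟩, ?_⟩
  · rintro rfl
    simp at hR1
  · rintro x ⟨hx, hx1, t, -, -, hMx⟩
    exact (hM.eq_of_mulVec_eq hr hL hR hR1 hLM hMR (fun i => (hx i).le) hx1 hMx).2

namespace RandomSubstitution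

variable {A : Type u} (θ : RandomSubstitution.{u, v} A) (p : θ.Weights)

theorem IsImage.length_le {θ : RandomSubstitution.{u, v} A} {x y : List A} (h : θ.IsImage x y) :
    x.length ≤ y.length := by
  induction h with
  | nil => simp
  | cons a q h ih =>
    have := List.length_pos_of_ne_nil (θ.word_ne_nil a q)
    simp only [List.length_cons, List.length_append]
    omega

/-- The expectation of `f` over the random image of a word. -/
noncomputable def imageExpectation : List A → (List A → ℝ) → ℝ
  | [], f => f []
  | a :: x, f => ∑ q, p a q * imageExpectation x fun y => f (θ.word a q ++ y)

theorem imageExpectation_append (x x' : List A) (f : List A → ℝ) :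
    θ.imageExpectation p (x ++ x') f =
      θ.imageExpectation p x fun y => θ.imageExpectation p x' fun y' => f (y ++ y') := by
  induction x generalizing f with
  | nil => simp [imageExpectation]
  | cons a x ih => simp [imageExpectation, ih]

theorem imageExpectation_congr {x : List A} {f g : List A → ℝ}
    (h : ∀ y, θ.IsImage x y → f y = g y) :
    θ.imageExpectation p x f = θ.imageExpectation p x g := by
  induction x generalizing f g with
  | nil => exact h _ .nil
  | cons a x ih =>
    exact Finset.sum_congr rfl fun q _ => by rw [ih fun y hy => h _ (.cons a q hy)]

theorem imageExpectation_sub (x : List A) (f g : List A → ℝ) :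
    θ.imageExpectation p x (fun y => f y - g y) =
      θ.imageExpectation p x f - θ.imageExpectation p x g := by
  induction x generalizing f g with
  | nil => rfl
  | cons a x ih => simp [imageExpectation, ih, mul_sub]

variable {p}

theorem imageExpectation_const (hp : ∀ a, p a ∈ stdSimplex ℝ (θ.Idx a)) (x : List A) (c : ℝ) :
    θ.imageExpectation p x (fun _ => c) = c := by
  induction x with
  | nil => rfl
  | cons a x ih => simp only [imageExpectation, ih, ← Finset.sum_mul, (hp a).2, one_mul]

theorem abs_imageExpectation_le (hp : ∀ a, p a ∈ stdSimplex ℝ (θ.Idx a)) (x : List A)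
    {f : List A → ℝ} {c : ℝ} (hf : ∀ y, |f y| ≤ c) : |θ.imageExpectation p x f| ≤ c := by
  induction x generalizing f with
  | nil => exact hf _
  | cons a x ih =>
    calc |θ.imageExpectation p (a :: x) f|
        ≤ ∑ q, p a q * c := by
          refine (Finset.abs_sum_le_sum_abs _ _).trans (Finset.sum_le_sum fun q _ => ?_)
          rw [abs_mul, abs_of_nonneg ((hp a).1 q)]
          exact mul_le_mul_of_nonneg_left (ih fun y => hf _) ((hp a).1 q)
      _ = c := by rw [← Finset.sum_mul, (hp a).2, one_mul]

/-- Letters beyond the first `n` do not influence the first `n` letters of the image. -/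
theorem imageExpectation_append_take (hp : ∀ a, p a ∈ stdSimplex ℝ (θ.Idx a)) {n : ℕ} {x : List A}
    (hx : n ≤ x.length) (x' : List A) (g : List A → ℝ) :
    θ.imageExpectation p (x ++ x') (fun y => g (y.take n)) =
      θ.imageExpectation p x fun y => g (y.take n) := by
  rw [imageExpectation_append]
  refine θ.imageExpectation_congr p fun y hy => ?_
  have := hx.trans hy.length_le
  simp only [List.take_append_of_le_length this]
  exact θ.imageExpectation_const hp x' _

variable (p)

theorem sum_prod_mul_wordImage {n : ℕ} (x : Fin n → A) (f : List A → ℝ) :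
    ∑ c : ∀ i, θ.Idx (x i), (∏ i, p (x i) (c i)) * f (θ.wordImage x c) =
      θ.imageExpectation p (List.ofFn x) f := by
  induction n generalizing f with
  | zero => simp [imageExpectation, wordImage]
  | succ n ih =>
    rw [← (Fin.consEquiv fun i => θ.Idx (x i)).sum_comp, Fintype.sum_prod_type]
    simp only [List.ofFn_succ, imageExpectation, ← ih, Finset.mul_sum]
    refine Finset.sum_congr rfl fun q _ => Finset.sum_congr rfl fun c _ => ?_
    simp [Fin.prod_univ_succ, wordImage, List.ofFn_succ, mul_assoc, Fin.consEquiv]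

/-- The expectation of the sum of `g` over all subwords of length `ℓ` of the random image of a word
that start in the image of the first letter. -/
noncomputable def windowExpectation (ℓ : ℕ) (g : List A → ℝ) : List A → ℝ
  | [] => 0
  | a :: x => ∑ q, p a q * θ.imageExpectation p x fun y =>
      ∑ k ∈ Finset.range (θ.word a q).length, g (((θ.word a q ++ y).drop k).take ℓ)

theorem ofFn_window {ℓ : ℕ} [NeZero ℓ] (x : Fin ℓ → A) (c : ∀ i, θ.Idx (x i))
    (k : Fin (θ.word (x 0) (c 0)).length) :
    List.ofFn (θ.window x c k) = ((θ.wordImage x c).drop k).take ℓ := by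
  apply List.ext_getElem
  · have h := θ.window_lt x c k ⟨ℓ - 1, Nat.sub_lt (NeZero.pos ℓ) one_pos⟩
    simp only at h
    have h1 := NeZero.pos ℓ
    simp only [List.length_ofFn, List.length_take, List.length_drop]
    omega
  · intro i h1 h2
    simp [window]

theorem sum_mul_count {B : Type*} [Fintype B] [DecidableEq B] (f : B → ℝ) (s : List B) :
    ∑ b, f b * (s.count b : ℝ) = (s.map f).sum := by
  induction s with
  | nil => simp
  | cons a s ih => simp [List.count_cons, mul_add, Finset.sum_add_distrib, ih, add_comm]

theorem sum_mul_substMatrix [Fintype A] [DecidableEq A] (f : A → ℝ) (a : A) :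
    ∑ b, f b * θ.substMatrix p b a = ∑ q, p a q * ((θ.word a q).map f).sum := by
  simp only [substMatrix, Matrix.of_apply, Finset.mul_sum]
  rw [Finset.sum_comm]
  refine Finset.sum_congr rfl fun q _ => ?_
  rw [← sum_mul_count, Finset.mul_sum]
  exact Finset.sum_congr rfl fun b _ => by ring

theorem sum_mul_inducedMatrix [Finite A] [DecidableEq A] {n : ℕ} (g : List A → ℝ)
    (w : θ.LegalWord (n + 1)) :
    ∑ u : θ.LegalWord (n + 1), g (List.ofFn u.1) * θ.inducedMatrix p (n + 1) u w =
      θ.windowExpectation p (n + 1) g (List.ofFn w.1) := by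
  have h1 : ∀ c : ∀ i, θ.Idx (w.1 i),
      (((θ.induced (n + 1)).word w c).map fun u => g (List.ofFn u.1)).sum =
        ∑ k ∈ Finset.range (θ.word (w.1 0) (c 0)).length,
          g (((θ.wordImage w.1 c).drop k).take (n + 1)) := by
    intro c
    simp only [induced, List.map_ofFn, List.sum_ofFn, Finset.sum_range, Function.comp_def]
    exact Finset.sum_congr rfl fun k _ => congrArg g (θ.ofFn_window w.1 c k)
  refine ((θ.induced (n + 1)).sum_mul_substMatrix (θ.inducedWeights p (n + 1))
    (fun u => g (List.ofFn u.1)) w).trans ?_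
  refine (Finset.sum_congr rfl fun c _ => congrArg (_ * ·) (h1 c)).trans ?_
  obtain ⟨x, hx⟩ := w
  change ∑ c : ∀ i, θ.Idx (x i), (∏ i, p (x i) (c i)) * _ = _
  rw [← (Fin.consEquiv fun i => θ.Idx (x i)).sum_comp, Fintype.sum_prod_type]
  simp only [List.ofFn_succ, windowExpectation, ← sum_prod_mul_wordImage, Finset.mul_sum]
  refine Finset.sum_congr rfl fun q _ => Finset.sum_congr rfl fun c _ => ?_
  simp [Fin.prod_univ_succ, wordImage, List.ofFn_succ, mul_assoc, Fin.consEquiv]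

variable {p}

theorem windowExpectation_append (hp : ∀ a, p a ∈ stdSimplex ℝ (θ.Idx a)) {ℓ : ℕ} {x : List A}
    (hx0 : x ≠ []) (hx : ℓ ≤ x.length) (x' : List A) (g : List A → ℝ) :
    θ.windowExpectation p ℓ g (x ++ x') = θ.windowExpectation p ℓ g x := by
  obtain _ | ⟨a, x⟩ := x
  · exact absurd rfl hx0
  simp only [windowExpectation, List.cons_append, imageExpectation_append]
  refine Finset.sum_congr rfl fun q _ => ?_
  congr 1
  refine θ.imageExpectation_congr p fun y hy => ?_
  have h1 := hy.length_le
  have : ∀ y' : List A, ∑ k ∈ Finset.range (θ.word a q).length,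
      g (((θ.word a q ++ (y ++ y')).drop k).take ℓ) =
      ∑ k ∈ Finset.range (θ.word a q).length, g (((θ.word a q ++ y).drop k).take ℓ) := by
    intro y'
    refine Finset.sum_congr rfl fun k hk => ?_
    have hk := Finset.mem_range.1 hk
    rw [← List.append_assoc, List.drop_append_of_le_length (by simp; omega),
      List.take_append_of_le_length]
    simp only [List.length_cons] at hx
    simp only [List.length_drop, List.length_append]
    omega
  simp only [this]
  exact θ.imageExpectation_const hp x' _

theorem windowExpectation_take {ℓ m : ℕ} (h : m ≤ ℓ) (g : List A → ℝ) (x : List A) :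
    θ.windowExpectation p ℓ (fun y => g (y.take m)) x = θ.windowExpectation p m g x := by
  cases x with
  | nil => rfl
  | cons a x => simp [windowExpectation, List.take_take, min_eq_left h]

/-- The difference of `g` on the last and on the first `n` letters of a word. -/
def edgeDiff (n : ℕ) (g : List A → ℝ) (y : List A) : ℝ :=
  g (y.drop 1) - g (y.take n)

theorem windowExpectation_edgeDiff (hp : ∀ a, p a ∈ stdSimplex ℝ (θ.Idx a)) {n : ℕ} {x : List A}
    (hx : x.length = n + 1) (g : List A → ℝ) :
    θ.windowExpectation p (n + 1) (edgeDiff n g) x =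
      edgeDiff n (fun z => θ.imageExpectation p z fun y => g (y.take n)) x := by
  obtain _ | ⟨a, x⟩ := x
  · simp at hx
  have h1 : θ.imageExpectation p ((a :: x).take n) (fun y => g (y.take n)) =
      θ.imageExpectation p (a :: x) (fun y => g (y.take n)) := by
    conv_rhs => rw [← List.take_append_drop n (a :: x)]
    exact (θ.imageExpectation_append_take hp (by simp [hx]) _ _).symm
  simp only [edgeDiff, h1, List.drop_one, List.tail_cons]
  have h2 : θ.imageExpectation p x (fun y => g (y.take n)) =
      ∑ q, p a q * θ.imageExpectation p x (fun y => g (y.take n)) := by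
    rw [← Finset.sum_mul, (hp a).2, one_mul]
  rw [h2, windowExpectation, imageExpectation, ← Finset.sum_sub_distrib]
  refine Finset.sum_congr rfl fun q _ => ?_
  rw [← mul_sub, ← imageExpectation_sub]
  congr 2
  funext y
  have h3 := Finset.sum_range_sub (fun k => g (((θ.word a q ++ y).drop k).take n))
    (θ.word a q).length
  simp only [List.drop_left, List.drop_zero] at h3
  rw [← h3]
  refine Finset.sum_congr rfl fun k _ => ?_
  unfold edgeDiff
  congr 2
  · rw [List.drop_take, List.drop_drop, Nat.add_sub_cancel]
  · rw [List.take_take, min_eq_left n.le_succ]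

/-- The weight of the first letter of a word. -/
def headWeight (L : A → ℝ) : List A → ℝ
  | [] => 0
  | a :: _ => L a

theorem windowExpectation_headWeight [Fintype A] [DecidableEq A]
    (hp : ∀ a, p a ∈ stdSimplex ℝ (θ.Idx a)) (n : ℕ) (L : A → ℝ) (a : A) (x : List A) :
    θ.windowExpectation p (n + 1) (headWeight L) (a :: x) =
      Matrix.vecMul L (θ.substMatrix p) a := by
  have h1 : ∀ s y : List A, ∑ k ∈ Finset.range s.length,
      headWeight L (((s ++ y).drop k).take (n + 1)) = (s.map L).sum := by
    intro s y
    induction s with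
    | nil => simp
    | cons b s ih =>
      rw [List.length_cons, Finset.sum_range_succ']
      simp only [List.cons_append, List.drop_succ_cons, ih]
      simp [headWeight, add_comm]
  simp only [windowExpectation, h1, θ.imageExpectation_const hp]
  exact (θ.sum_mul_substMatrix p L a).symm

end RandomSubstitution

namespace RandomSubstitution

variable {A : Type u} {θ : RandomSubstitution.{u, v} A} {p : θ.Weights}

theorem exists_ofFn_eq {n : ℕ} {l : List A} (h : l.length = n) : ∃ x : Fin n → A, List.ofFn x = l := by
  subst h
  exact ⟨l.get, List.ofFn_get l⟩

theorem IsImage.exists_append {x x' y : List A} (h : θ.IsImage (x ++ x') y) :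
    ∃ z z', θ.IsImage x z ∧ θ.IsImage x' z' ∧ y = z ++ z' := by
  induction x generalizing y with
  | nil => exact ⟨[], y, .nil, h, rfl⟩
  | cons a x ih =>
    rw [List.cons_append] at h
    obtain _ | ⟨_, q, h⟩ := h
    obtain ⟨z, z', hz, hz', rfl⟩ := ih h
    exact ⟨_, z', .cons a q hz, hz', (List.append_assoc _ _ _).symm⟩

theorem isImage_singleton (a : A) (q : θ.Idx a) : θ.IsImage [a] (θ.word a q) := by
  simpa using IsImage.cons a q IsImage.nil

theorem IsRealisation.append {k : ℕ} {x x' y y' : List A} (h : θ.IsRealisation k x y)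
    (h' : θ.IsRealisation k x' y') : θ.IsRealisation k (x ++ x') (y ++ y') := by
  induction k generalizing y y' with
  | zero => rw [show y = x from h, show y' = x' from h']; rfl
  | succ k ih =>
    obtain ⟨z, hz, hy⟩ := h
    obtain ⟨z', hz', hy'⟩ := h'
    exact ⟨_, ih hz hz', hy.append hy'⟩

theorem IsRealisation.length_le {k : ℕ} {x y : List A} (h : θ.IsRealisation k x y) :
    x.length ≤ y.length := by
  induction k generalizing y with
  | zero => rw [show y = x from h]
  | succ k ih =>
    obtain ⟨z, hz, hy⟩ := h
    exact (ih hz).trans hy.length_le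

theorem IsRealisation.trans {k m : ℕ} {x y z : List A} (h : θ.IsRealisation k x y)
    (h' : θ.IsRealisation m y z) : θ.IsRealisation (k + m) x z := by
  induction m generalizing z with
  | zero => rw [show z = y from h']; exact h
  | succ m ih =>
    obtain ⟨t, ht, hz⟩ := h'
    exact ⟨t, ih ht, hz⟩

theorem exists_isRealisation (θ : RandomSubstitution.{u, v} A) (k : ℕ) (x : List A) :
    ∃ y, θ.IsRealisation k x y := by
  induction k with
  | zero => exact ⟨x, rfl⟩
  | succ k ih =>
    obtain ⟨z, hz⟩ := ih
    obtain ⟨y, hy⟩ := θ.exists_isImage z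
    exact ⟨y, z, hz, hy⟩

theorem Legal.of_infix {x y : List A} (h : θ.Legal y) (hxy : x <:+: y) : θ.Legal x := by
  obtain ⟨k, a, z, hz, hyz⟩ := h
  exact ⟨k, a, z, hz, hxy.trans hyz⟩

theorem legal_singleton (a : A) : θ.Legal [a] :=
  ⟨0, a, [a], rfl, List.infix_rfl⟩

theorem IsRealisation.exists_mem {m : ℕ} {a : A} {y z : List A} (h : θ.IsRealisation m [a] z)
    (ha : a ∈ y) : ∃ t, θ.IsRealisation m y t ∧ z <:+: t := by
  obtain ⟨s, s', rfl⟩ := List.append_of_mem ha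
  obtain ⟨t, ht⟩ := θ.exists_isRealisation m s
  obtain ⟨t', ht'⟩ := θ.exists_isRealisation m s'
  refine ⟨t ++ (z ++ t'), ht.append (?_ : θ.IsRealisation m ([a] ++ s') _), t, t', by simp⟩
  exact h.append ht'

theorem IsPrimitive.exists_forall_ge (h : θ.IsPrimitive) :
    ∃ K : ℕ, ∀ k ≥ K, ∀ a b : A, ∃ y, θ.IsRealisation k [b] y ∧ a ∈ y := by
  obtain ⟨K, hK⟩ := h
  refine ⟨K, fun k hk => Nat.le_induction hK (fun k _ ih a b => ?_) k hk⟩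
  have hne := θ.word_ne_nil b (Classical.arbitrary _)
  obtain ⟨y, hy, hay⟩ := ih a (List.head _ hne)
  obtain ⟨t, ht, hyt⟩ := hy.exists_mem (List.head_mem hne)
  refine ⟨t, ?_, hyt.subset hay⟩
  rw [add_comm]
  exact IsRealisation.trans (k := 1) ⟨[b], rfl, isImage_singleton b _⟩ ht

/-- Every legal word occurs in realisations of all sufficiently high powers of every letter. -/
theorem IsPrimitive.exists_forall_infix (h : θ.IsPrimitive) {x : List A} (hx : θ.Legal x) :
    ∃ K : ℕ, ∀ k ≥ K, ∀ b : A, ∃ y, θ.IsRealisation k [b] y ∧ x <:+: y := by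
  obtain ⟨K, hK⟩ := h.exists_forall_ge
  obtain ⟨j, a, z, hz, hxz⟩ := hx
  refine ⟨K + j, fun k hk b => ?_⟩
  obtain ⟨y, hy, hay⟩ := hK (k - j) (by omega) a b
  obtain ⟨t, ht, hzt⟩ := hz.exists_mem hay
  refine ⟨t, ?_, hxz.trans hzt⟩
  have := hy.trans ht
  rwa [Nat.sub_add_cancel (by omega)] at this

theorem substMatrix_nonneg [DecidableEq A] (hp : ∀ a q, 0 ≤ p a q) (a b : A) :
    0 ≤ θ.substMatrix p a b :=
  Finset.sum_nonneg fun _ _ => mul_nonneg (hp _ _) (Nat.cast_nonneg _)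

theorem substMatrix_pos [DecidableEq A] (hp : ∀ a q, 0 ≤ p a q) {a b : A} {q : θ.Idx b}
    (hq : 0 < p b q) (h : a ∈ θ.word b q) : 0 < θ.substMatrix p a b :=
  Finset.sum_pos' (fun _ _ => mul_nonneg (hp _ _) (Nat.cast_nonneg _))
    ⟨q, Finset.mem_univ _, mul_pos hq (Nat.cast_pos.2 (List.count_pos_iff.2 h))⟩

theorem exists_of_substMatrix_ne_zero [DecidableEq A] {a b : A} (h : θ.substMatrix p a b ≠ 0) :
    ∃ q, p b q ≠ 0 ∧ a ∈ θ.word b q := by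
  obtain ⟨q, -, hq⟩ := Finset.exists_ne_zero_of_sum_ne_zero h
  refine ⟨q, left_ne_zero_of_mul hq, ?_⟩
  have h1 := right_ne_zero_of_mul hq
  rwa [Nat.cast_ne_zero, ← Nat.pos_iff_ne_zero, List.count_pos_iff] at h1

theorem inducedMatrix_nonneg [Finite A] [DecidableEq A] (hp : ∀ a q, 0 ≤ p a q) {ℓ : ℕ} [NeZero ℓ]
    (u w : θ.LegalWord ℓ) : 0 ≤ θ.inducedMatrix p ℓ u w :=
  Finset.sum_nonneg fun _ _ => mul_nonneg (Finset.prod_nonneg fun _ _ => hp _ _) (Nat.cast_nonneg _)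

theorem inducedMatrix_pos [Finite A] [DecidableEq A] (hp : ∀ a q, 0 ≤ p a q) {n : ℕ}
    {u w : θ.LegalWord (n + 1)} (c : ∀ i, θ.Idx (w.1 i)) (hc : ∀ i, 0 < p (w.1 i) (c i)) {k : ℕ}
    (hk : k < (θ.word (w.1 0) (c 0)).length)
    (hu : List.ofFn u.1 = ((θ.wordImage w.1 c).drop k).take (n + 1)) :
    0 < θ.inducedMatrix p (n + 1) u w := by
  refine (θ.induced (n + 1)).substMatrix_pos (fun _ _ => Finset.prod_nonneg fun _ _ => hp _ _)
    (q := c) (Finset.prod_pos fun i _ => hc i) ?_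
  refine List.mem_ofFn.2 ⟨⟨k, hk⟩, Subtype.ext (List.ofFn_injective ?_)⟩
  rw [hu]
  exact θ.ofFn_window w.1 c ⟨k, hk⟩

theorem exists_of_inducedMatrix_ne_zero [Finite A] [DecidableEq A] {n : ℕ}
    {u w : θ.LegalWord (n + 1)} (h : θ.inducedMatrix p (n + 1) u w ≠ 0) :
    ∃ c : ∀ i, θ.Idx (w.1 i), (∀ i, p (w.1 i) (c i) ≠ 0) ∧
      List.ofFn u.1 <:+: θ.wordImage w.1 c := by
  obtain ⟨c, hc, hu⟩ := exists_of_substMatrix_ne_zero h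
  refine ⟨c, fun i => Finset.prod_ne_zero_iff.1 hc i (Finset.mem_univ i), ?_⟩
  obtain ⟨k, rfl⟩ := List.mem_ofFn.1 hu
  simp only
  rw [θ.ofFn_window w.1 c k]
  exact (List.take_prefix _ _).isInfix.trans (List.drop_suffix _ _).isInfix

/-- The images under `σ` are precisely the images under `θ` that have nonzero weight. -/
structure IsSupport (θ : RandomSubstitution.{u, v} A) (p : θ.Weights)
    (σ : RandomSubstitution.{u, v} A) : Prop where
  exists_pos : ∀ a i, ∃ q, 0 < p a q ∧ θ.word a q = σ.word a i
  exists_word : ∀ a q, p a q ≠ 0 → ∃ i, σ.word a i = θ.word a q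

variable {σ : RandomSubstitution.{u, v} A}

theorem IsSupport.isImage (h : θ.IsSupport p σ) {x y : List A} (hxy : σ.IsImage x y) :
    θ.IsImage x y := by
  induction hxy with
  | nil => exact .nil
  | cons a i _ ih =>
    obtain ⟨q, -, hq⟩ := h.exists_pos a i
    rw [← hq]
    exact .cons a q ih

theorem IsSupport.isRealisation (h : θ.IsSupport p σ) {k : ℕ} {x y : List A}
    (hxy : σ.IsRealisation k x y) : θ.IsRealisation k x y := by
  induction k generalizing y with
  | zero => exact hxy
  | succ k ih =>
    obtain ⟨z, hz, hy⟩ := hxy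
    exact ⟨z, ih hz, h.isImage hy⟩

theorem IsSupport.legal (h : θ.IsSupport p σ) {x : List A} (hx : σ.Legal x) : θ.Legal x := by
  obtain ⟨k, a, y, hy, hxy⟩ := hx
  exact ⟨k, a, y, h.isRealisation hy, hxy⟩

theorem IsSupport.exists_wordImage_eq (h : θ.IsSupport p σ) {n : ℕ} {x : Fin n → A} {y : List A}
    (hy : σ.IsImage (List.ofFn x) y) :
    ∃ c : ∀ i, θ.Idx (x i), (∀ i, 0 < p (x i) (c i)) ∧ θ.wordImage x c = y := by
  induction n generalizing y with
  | zero =>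
    rw [List.ofFn_zero] at hy
    cases hy
    exact ⟨fun i => i.elim0, fun i => i.elim0, by simp [wordImage]⟩
  | succ n ih =>
    rw [List.ofFn_succ] at hy
    obtain _ | ⟨_, i, hy⟩ := hy
    obtain ⟨c, hc, rfl⟩ := ih hy
    obtain ⟨q, hq, hq'⟩ := h.exists_pos _ i
    refine ⟨Fin.cons q c, fun j => ?_, ?_⟩
    · refine Fin.cases ?_ (fun j => ?_) j
      · exact hq
      · exact hc j
    · simp [wordImage, List.ofFn_succ, hq']

theorem IsSupport.isImage_wordImage (h : θ.IsSupport p σ) {n : ℕ} {x : Fin n → A}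
    (c : ∀ i, θ.Idx (x i)) (hc : ∀ i, p (x i) (c i) ≠ 0) :
    σ.IsImage (List.ofFn x) (θ.wordImage x c) := by
  induction n with
  | zero => simpa [wordImage] using IsImage.nil
  | succ n ih =>
    obtain ⟨i, hi⟩ := h.exists_word _ _ (hc 0)
    simpa [wordImage, List.ofFn_succ, hi] using
      IsImage.cons (x 0) i (ih (fun i => c i.succ) fun i => hc i.succ)

section Matrices

variable [Finite A] [DecidableEq A]

/-- A word that starts in the image of `s` is the image, with positive weight, of a word that
starts in `s`. -/
theorem IsSupport.exists_inducedMatrix_pos (h : θ.IsSupport p σ) (hp : ∀ a q, 0 ≤ p a q) {n : ℕ}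
    {s t y y' : List A} (hs : σ.IsImage s y) (ht : σ.IsImage t y') (hn : n ≤ t.length)
    (hst : θ.Legal (s ++ t)) {i : ℕ} (hi : i < y.length) {u : θ.LegalWord (n + 1)}
    (hu : List.ofFn u.1 = ((y ++ y').drop i).take (n + 1)) :
    ∃ j < s.length, ∃ w : θ.LegalWord (n + 1),
      List.ofFn w.1 = ((s ++ t).drop j).take (n + 1) ∧ 0 < θ.inducedMatrix p (n + 1) u w := by
  induction hs generalizing i with
  | nil => simp at hi
  | @cons a q s y hs ih =>
    by_cases hiq : i < (σ.word a q).length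
    · refine ⟨0, by simp, ?_⟩
      have himg := hs.append ht
      rw [← List.take_append_drop n (s ++ t)] at himg
      obtain ⟨z, z', hz, -, hzz⟩ := himg.exists_append
      obtain ⟨x, hx⟩ := exists_ofFn_eq (n := n) (l := (s ++ t).take n) (by simp; omega)
      rw [← hx] at hz
      obtain ⟨c, hc, rfl⟩ := h.exists_wordImage_eq hz
      obtain ⟨q', hq, hq'⟩ := h.exists_pos a q
      have hw : List.ofFn (Fin.cons a x : Fin (n + 1) → A) = (a :: (s ++ t)).take (n + 1) := by
        simp [List.ofFn_succ, hx]
      refine ⟨⟨Fin.cons a x, ?_⟩, by simpa using hw, ?_⟩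
      · rw [hw]
        exact hst.of_infix (List.take_prefix _ _).isInfix
      · refine inducedMatrix_pos hp (w := ⟨Fin.cons a x, _⟩)
          (Fin.cons (α := fun i => θ.Idx ((Fin.cons a x : Fin (n + 1) → A) i)) q' c)
          (fun j => ?_) (k := i) ?_ ?_
        · refine Fin.cases ?_ (fun j => ?_) j
          · exact hq
          · exact hc j
        · change i < (θ.word a q').length
          rwa [hq']
        · have e : θ.wordImage (Fin.cons a x : Fin (n + 1) → A)
              (Fin.cons (α := fun i => θ.Idx ((Fin.cons a x : Fin (n + 1) → A) i)) q' c) =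
              σ.word a q ++ θ.wordImage x c := by
            simp only [wordImage, List.ofFn_succ, List.flatten_cons]
            rw [← hq']
            rfl
          have hl := θ.le_length_wordImage x c
          rw [hu, e, List.append_assoc, hzz, ← List.append_assoc,
            List.drop_append_of_le_length (by simp; omega), List.take_append_of_le_length]
          simp only [List.length_drop, List.length_append]
          omega
    · obtain ⟨j, hj, w, hw, hpos⟩ := ih (hst.of_infix (List.suffix_cons a _).isInfix)
        (i := i - (σ.word a q).length) (by simp at hi; omega) (by
          rw [hu, List.append_assoc, List.drop_append, List.drop_eq_nil_of_le (by omega),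
            List.nil_append])
      exact ⟨j + 1, by simpa using hj, w, by simpa using hw, hpos⟩

theorem IsSupport.exists_inducedMatrix_pow_pos (h : θ.IsSupport p σ) (hp : ∀ a q, 0 ≤ p a q)
    {n k : ℕ} {s t y y' : List A} (hs : σ.IsRealisation k s y) (ht : σ.IsRealisation k t y')
    (hn : n ≤ t.length) (hst : θ.Legal (s ++ t)) {i : ℕ} (hi : i < y.length)
    {u : θ.LegalWord (n + 1)} (hu : List.ofFn u.1 = ((y ++ y').drop i).take (n + 1)) :
    ∃ j < s.length, ∃ w : θ.LegalWord (n + 1),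
      List.ofFn w.1 = ((s ++ t).drop j).take (n + 1) ∧
        0 < (θ.inducedMatrix p (n + 1) ^ k) u w := by
  induction k generalizing y y' i u with
  | zero =>
    obtain rfl : y = s := hs
    obtain rfl : y' = t := ht
    exact ⟨i, hi, u, hu, by simp⟩
  | succ k ih =>
    obtain ⟨z, hz, hy⟩ := hs
    obtain ⟨z', hz', hy'⟩ := ht
    have hleg : θ.Legal (z ++ z') := by
      obtain ⟨m, a, x, hx, hsx⟩ := hst
      obtain ⟨r, r', rfl⟩ := hsx
      obtain ⟨e, he⟩ := θ.exists_isRealisation k r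
      obtain ⟨e', he'⟩ := θ.exists_isRealisation k r'
      exact ⟨m + k, a, _, hx.trans ((he.append (h.isRealisation (hz.append hz'))).append he'),
        e, e', rfl⟩
    obtain ⟨j, hj, v, hv, hpos⟩ := h.exists_inducedMatrix_pos hp hy hy' (hn.trans hz'.length_le)
      hleg hi hu
    obtain ⟨j', hj', w, hw, hpos'⟩ := ih hz hz' hj hv
    refine ⟨j', hj', w, hw, ?_⟩
    rw [pow_succ', Matrix.mul_apply]
    have h0 : ∀ u w, 0 ≤ (θ.inducedMatrix p (n + 1) ^ k) u w :=
      fun u w => Matrix.pow_apply_nonneg (fun _ _ => inducedMatrix_nonneg hp _ _) k u w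
    exact Finset.sum_pos' (fun v _ => mul_nonneg (inducedMatrix_nonneg hp _ _) (h0 _ _))
      ⟨v, Finset.mem_univ _, mul_pos hpos hpos'⟩

theorem IsSupport.inducedMatrix_pow_pos (h : θ.IsSupport p σ) (hp : ∀ a q, 0 ≤ p a q)
    {n k : ℕ} {u w : θ.LegalWord (n + 1)} {y : List A} (hy : σ.IsRealisation k [w.1 0] y)
    (hu : List.ofFn u.1 <:+: y) : 0 < (θ.inducedMatrix p (n + 1) ^ k) u w := by
  obtain ⟨y', hy'⟩ := σ.exists_isRealisation k (List.ofFn fun i : Fin n => w.1 i.succ)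
  obtain ⟨s, s', rfl⟩ := hu
  have e : [w.1 0] ++ List.ofFn (fun i : Fin n => w.1 i.succ) = List.ofFn w.1 := by
    simp [List.ofFn_succ]
  obtain ⟨j, hj, w', hw', hpos⟩ := h.exists_inducedMatrix_pow_pos hp hy hy' (by simp)
    (by rw [e]; exact w.2) (i := s.length) (by simp) (u := u) (by
      rw [List.append_assoc, List.append_assoc, List.drop_left, List.take_left' (by simp)])
  obtain rfl : j = 0 := by simpa using hj
  rw [e, List.drop_zero, List.take_of_length_le (by simp)] at hw'
  rwa [Subtype.ext (List.ofFn_injective hw') ] at hpos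

theorem IsSupport.isPrimitive_inducedMatrix (h : θ.IsSupport p σ) (hp : ∀ a q, 0 ≤ p a q)
    (hσ : σ.IsPrimitive) (hleg : ∀ x, θ.Legal x → σ.Legal x) {ℓ : ℕ} [NeZero ℓ] :
    (θ.inducedMatrix p ℓ).IsPrimitive := by
  obtain ⟨n, rfl⟩ := Nat.exists_eq_succ_of_ne_zero (NeZero.ne ℓ)
  refine ⟨fun _ _ => inducedMatrix_nonneg hp _ _, ?_⟩
  choose K hK using fun u : θ.LegalWord (n + 1) => hσ.exists_forall_infix (hleg _ u.2)
  refine ⟨(∑ u, K u) + 1, Nat.succ_pos _, fun u w => ?_⟩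
  obtain ⟨y, hy, huy⟩ := hK u ((∑ u, K u) + 1)
    ((Finset.single_le_sum (fun u _ => Nat.zero_le (K u)) (Finset.mem_univ u)).trans
      (Nat.le_succ _)) (w.1 0)
  exact h.inducedMatrix_pow_pos hp hy huy

theorem IsSupport.isPrimitive_substMatrix [Fintype A] (h : θ.IsSupport p σ)
    (hp : ∀ a q, 0 ≤ p a q) (hσ : σ.IsPrimitive) : (θ.substMatrix p).IsPrimitive := by
  have h0 : ∀ a b, 0 ≤ θ.substMatrix p a b := substMatrix_nonneg hp
  have hpos : ∀ {b : A} {k : ℕ} {y : List A}, σ.IsRealisation k [b] y → ∀ a ∈ y,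
      0 < (θ.substMatrix p ^ k) a b := by
    intro b k y hy a ha
    induction k generalizing y a with
    | zero =>
      rw [show y = [b] from hy, List.mem_singleton] at ha
      simp [ha]
    | succ k ih =>
      obtain ⟨z, hz, hy⟩ := hy
      have h1 : ∃ c ∈ z, 0 < θ.substMatrix p a c := by
        clear hz
        induction hy with
        | nil => simp at ha
        | cons c i _ ih' =>
          rw [List.mem_append] at ha
          rcases ha with ha | ha
          · obtain ⟨q, hq, hq'⟩ := h.exists_pos c i
            exact ⟨c, List.mem_cons_self, substMatrix_pos hp hq (hq' ▸ ha)⟩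
          · obtain ⟨d, hd, hd'⟩ := ih' ha
            exact ⟨d, List.mem_cons_of_mem _ hd, hd'⟩
      obtain ⟨c, hc, hac⟩ := h1
      rw [pow_succ', Matrix.mul_apply]
      exact Finset.sum_pos' (fun v _ => mul_nonneg (h0 _ _) (Matrix.pow_apply_nonneg h0 k _ _))
        ⟨c, Finset.mem_univ _, mul_pos hac (ih hz c hc)⟩
  obtain ⟨K, hK⟩ := hσ.exists_forall_ge
  refine ⟨h0, K + 1, Nat.succ_pos K, fun a b => ?_⟩
  obtain ⟨y, hy, hay⟩ := hK (K + 1) (Nat.le_succ K) a b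
  exact hpos hy a hay

end Matrices

theorem IsNondegenerateProb.pos (hp : θ.IsNondegenerateProb p) (a : A) (q : θ.Idx a) : 0 < p a q :=
  lt_of_le_of_ne ((hp.1 a).1 q) (hp.2 a q).symm

theorem IsNondegenerateProb.isSupport (hp : θ.IsNondegenerateProb p) : θ.IsSupport p θ :=
  ⟨fun a i => ⟨i, hp.pos a i, rfl⟩, fun _ q _ => ⟨q, rfl⟩⟩

end RandomSubstitution

namespace RandomSubstitution

variable {A : Type u} {θ σ : RandomSubstitution.{u, v} A} {p : θ.Weights}

theorem exists_two_le_length (hne : θ.subshift.Nonempty) :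
    ∃ a q, 2 ≤ (θ.word a q).length := by
  by_contra! hcon
  obtain ⟨x, hx⟩ := hne
  obtain ⟨k, a, y, hy, hxy⟩ := hx 0 2
  have h1 : ∀ {z y : List A}, θ.IsImage z y → y.length ≤ z.length := by
    intro z y h
    induction h with
    | nil => simp
    | cons a q _ ih =>
      have := hcon a q
      simp only [List.length_append, List.length_cons]
      omega
  have h2 : ∀ (k : ℕ) (y : List A), θ.IsRealisation k [a] y → y.length ≤ 1 := by
    intro k
    induction k with
    | zero => intro y h; rw [show y = [a] from h]; simp
    | succ k ih => rintro y ⟨z, hz, hy⟩; exact (h1 hy).trans (ih z hz)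
  have := hxy.length_le.trans (h2 k y hy)
  simp at this

theorem nonempty_legalWord (hne : θ.subshift.Nonempty) (ℓ : ℕ) : Nonempty (θ.LegalWord ℓ) := by
  obtain ⟨x, hx⟩ := hne
  exact ⟨⟨_, hx 0 ℓ⟩⟩

theorem IsSupport.exists_letter_weights [Fintype A] [DecidableEq A] [Nonempty A]
    (h : θ.IsSupport p σ) (hp : ∀ a, p a ∈ stdSimplex ℝ (θ.Idx a)) (hσ : σ.IsPrimitive)
    (hg : ∃ a i, 2 ≤ (σ.word a i).length) :
    ∃ (L : A → ℝ) (r : ℝ), (∀ a, 0 < L a) ∧ 1 < r ∧ Matrix.vecMul L (θ.substMatrix p) = r • L := by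
  have hM := h.isPrimitive_substMatrix (fun a => (hp a).1) hσ
  obtain ⟨L, r, hL, -, -, hLM⟩ := hM.transpose.exists_pos_eigenvector
  obtain ⟨R, s, hR, hR1, -, hMR⟩ := hM.exists_pos_eigenvector
  rw [Matrix.mulVec_transpose] at hLM
  have hLR : 0 < L ⬝ᵥ R := Finset.sum_pos (fun i _ => mul_pos (hL i) (hR i)) Finset.univ_nonempty
  obtain rfl : s = r := Matrix.eigenvalue_eq_of_dotProduct_pos hLR hLM hMR
  refine ⟨L, s, hL, ?_, hLM⟩
  obtain ⟨a, i, hai⟩ := hg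
  obtain ⟨q, hq, hqi⟩ := h.exists_pos a i
  have hlen : ∀ b, ∑ c, 1 * θ.substMatrix p c b =
      ∑ q, p b q * ((θ.word b q).length : ℝ) := by
    intro b
    rw [θ.sum_mul_substMatrix p (fun _ => (1 : ℝ))]
    simp
  have h1 : ∀ b q, p b q ≤ p b q * ((θ.word b q).length : ℝ) := fun b q =>
    le_mul_of_one_le_right ((hp b).1 q)
      (by exact_mod_cast List.length_pos_of_ne_nil (θ.word_ne_nil b q))
  have h2 : ∑ b, (θ.substMatrix p).mulVec R b = s := by
    rw [hMR]
    simp [← Finset.mul_sum, hR1]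
  rw [← h2, ← hR1]
  simp only [Matrix.mulVec, dotProduct]
  rw [Finset.sum_comm]
  have h3 : ∀ b, ∑ c, θ.substMatrix p c b * R b =
      (∑ q, p b q * ((θ.word b q).length : ℝ)) * R b := by
    intro b
    rw [← hlen, Finset.sum_mul]
    simp
  simp only [h3]
  refine Finset.sum_lt_sum (fun b _ => le_mul_of_one_le_left (hR b).le ?_)
    ⟨a, Finset.mem_univ a, lt_mul_of_one_lt_left (hR a) ?_⟩
  · rw [← (hp b).2]
    exact Finset.sum_le_sum fun q _ => h1 b q
  · rw [← (hp a).2]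
    refine Finset.sum_lt_sum (fun q _ => h1 a q) ⟨q, Finset.mem_univ q, ?_⟩
    refine lt_mul_of_one_lt_right hq ?_
    rw [hqi]
    exact_mod_cast hai

section

variable [Finite A] [DecidableEq A]

theorem vecMul_inducedMatrix [Fintype A] (hp : ∀ a, p a ∈ stdSimplex ℝ (θ.Idx a)) {L : A → ℝ}
    {r : ℝ} (hL : Matrix.vecMul L (θ.substMatrix p) = r • L) (n : ℕ) :
    Matrix.vecMul (fun u : θ.LegalWord (n + 1) => L (u.1 0)) (θ.inducedMatrix p (n + 1)) =
      r • fun u : θ.LegalWord (n + 1) => L (u.1 0) := by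
  funext w
  have h := θ.sum_mul_inducedMatrix p (headWeight L) w
  simp only [List.ofFn_succ] at h
  rw [θ.windowExpectation_headWeight hp, hL] at h
  exact h

theorem IsNondegenerateProb.isPrimitive_inducedMatrix (hp : θ.IsNondegenerateProb p)
    (hprim : θ.IsPrimitive) (ℓ : ℕ) [NeZero ℓ] : (θ.inducedMatrix p ℓ).IsPrimitive :=
  hp.isSupport.isPrimitive_inducedMatrix (fun a => (hp.1 a).1) hprim fun _ h => h

theorem IsNondegenerateProb.existsUnique_isPerronVector (hp : θ.IsNondegenerateProb p)
    (hprim : θ.IsPrimitive) (hne : θ.subshift.Nonempty) (ℓ : ℕ) [NeZero ℓ] :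
    ∃! R, IsPerronVector (θ.inducedMatrix p ℓ) R :=
  have := nonempty_legalWord hne ℓ
  (hp.isPrimitive_inducedMatrix hprim ℓ).existsUnique_isPerronVector

theorem IsNondegenerateProb.isPerronVector (hp : θ.IsNondegenerateProb p)
    (hprim : θ.IsPrimitive) (hne : θ.subshift.Nonempty) (ℓ : ℕ) [NeZero ℓ] :
    IsPerronVector (θ.inducedMatrix p ℓ) (θ.perronVector p ℓ) :=
  Classical.epsilon_spec (hp.existsUnique_isPerronVector hprim hne ℓ).exists

/-- The expectation of `g` over the legal words of length `n + 1` with the weights `R`. -/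
noncomputable def legalSum {n : ℕ} (R : θ.LegalWord (n + 1) → ℝ) (g : List A → ℝ) : ℝ :=
  ∑ u : θ.LegalWord (n + 1), g (List.ofFn u.1) * R u

theorem legalSum_windowExpectation {n : ℕ} {R : θ.LegalWord (n + 1) → ℝ} {r : ℝ}
    (hR : (θ.inducedMatrix p (n + 1)).mulVec R = r • R) (g : List A → ℝ) :
    legalSum R (θ.windowExpectation p (n + 1) g) = r * legalSum R g := by
  have h : ∀ f : θ.LegalWord (n + 1) → ℝ,
      ∑ w, (∑ u, f u * θ.inducedMatrix p (n + 1) u w) * R w = r * ∑ u, f u * R u := by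
    intro f
    have := Matrix.dotProduct_mulVec f (θ.inducedMatrix p (n + 1)) R
    rw [hR, dotProduct_smul, smul_eq_mul] at this
    exact this.symm
  unfold legalSum
  rw [← h]
  exact Finset.sum_congr rfl fun w _ => by rw [sum_mul_inducedMatrix]

/-- The initial subword of a legal word. -/
def legalInit {n : ℕ} (u : θ.LegalWord (n + 1)) : θ.LegalWord n :=
  ⟨fun i => u.1 i.castSucc, u.2.of_infix (by
    rw [List.ofFn_succ' u.1, List.concat_eq_append]
    exact (List.prefix_append _ _).isInfix)⟩

theorem ofFn_legalInit {n : ℕ} (u : θ.LegalWord (n + 1)) :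
    List.ofFn (legalInit u).1 = (List.ofFn u.1).take n := by
  rw [List.ofFn_succ' u.1, List.concat_eq_append, List.take_left' (by simp)]
  rfl

variable (hp : θ.IsNondegenerateProb p) (hprim : θ.IsPrimitive) (hne : θ.subshift.Nonempty)
include hp hprim hne

theorem IsNondegenerateProb.exists_weights [Fintype A] :
    ∃ (L : A → ℝ) (r : ℝ), (∀ a, 0 < L a) ∧ 1 < r ∧
      Matrix.vecMul L (θ.substMatrix p) = r • L := by
  obtain ⟨x, -⟩ := id hne
  have : Nonempty A := ⟨x 0⟩
  exact hp.isSupport.exists_letter_weights hp.1 hprim (exists_two_le_length hne)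

theorem IsNondegenerateProb.legalSum_take (n : ℕ) (g : List A → ℝ) :
    legalSum (θ.perronVector p (n + 2)) (fun y => g (y.take (n + 1))) =
      legalSum (θ.perronVector p (n + 1)) g := by
  have := Fintype.ofFinite A
  obtain ⟨hR, hR1, s, hs, -, hMR⟩ := hp.isPerronVector hprim hne (n + 2)
  obtain ⟨hR', hR1', s', hs', -, hMR'⟩ := hp.isPerronVector hprim hne (n + 1)
  obtain ⟨L, r, hL, hr, hLM⟩ := hp.exists_weights hprim hne
  set R := θ.perronVector p (n + 2)
  set R' := θ.perronVector p (n + 1)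
  have hL' : ∀ u : θ.LegalWord (n + 1), 0 < L (u.1 0) := fun u => hL _
  have hM := hp.isPrimitive_inducedMatrix hprim (n + 1)
  have hr0 := zero_lt_one.trans hr
  have hsr : s' = r := by
    have hLR : 0 < (fun u : θ.LegalWord (n + 1) => L (u.1 0)) ⬝ᵥ R' :=
      have := nonempty_legalWord hne (n + 1)
      Finset.sum_pos (fun i _ => mul_pos (hL' i) (hR' i)) Finset.univ_nonempty
    exact Matrix.eigenvalue_eq_of_dotProduct_pos hLR (vecMul_inducedMatrix hp.1 hLM n) hMR'
  subst hsr
  set x : θ.LegalWord (n + 1) → ℝ := fun v => ∑ u, if legalInit u = v then R u else 0 with hx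
  have hx0 : ∀ v, 0 ≤ x v := fun v => Finset.sum_nonneg fun u _ => by
    split_ifs
    · exact (hR u).le
    · exact le_rfl
  have hdot : ∀ f : θ.LegalWord (n + 1) → ℝ, ∑ v, f v * x v = ∑ u, f (legalInit u) * R u := by
    intro f
    simp only [hx, Finset.mul_sum]
    rw [Finset.sum_comm]
    simp
  have hx1 : ∑ v, x v = 1 := by simpa [hR1] using hdot fun _ => 1
  have hMx : (θ.inducedMatrix p (n + 1)).mulVec x = s • x := by
    funext v
    have e1 : ∀ g : List A → ℝ, ∀ u : θ.LegalWord (n + 2),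
        ∑ v, g (List.ofFn v.1) * θ.inducedMatrix p (n + 1) v (legalInit u) =
        ∑ u', g ((List.ofFn u'.1).take (n + 1)) * θ.inducedMatrix p (n + 2) u' u := by
      intro g u
      rw [sum_mul_inducedMatrix, θ.sum_mul_inducedMatrix p fun y => g (y.take (n + 1)),
        θ.windowExpectation_take (n + 1).le_succ, ofFn_legalInit]
      conv_rhs => rw [← List.take_append_drop (n + 1) (List.ofFn u.1)]
      rw [θ.windowExpectation_append hp.1 (by simp [List.ofFn_succ]) (by simp)]
    have e2 : ∀ u, θ.inducedMatrix p (n + 1) v (legalInit u) =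
        ∑ u', if legalInit u' = v then θ.inducedMatrix p (n + 2) u' u else 0 := by
      intro u
      have := e1 (fun y => if y = List.ofFn v.1 then 1 else 0) u
      simp only [← ofFn_legalInit, List.ofFn_injective.eq_iff, ← Subtype.ext_iff, ite_mul, one_mul,
        zero_mul, Finset.sum_ite_eq', Finset.mem_univ, if_true] at this
      exact this
    have e3 := hdot fun v' => θ.inducedMatrix p (n + 1) v v'
    change ∑ v', θ.inducedMatrix p (n + 1) v v' * x v' = _
    rw [e3]
    simp only [e2, Finset.sum_mul]
    rw [Finset.sum_comm]
    simp only [hx, Pi.smul_apply, smul_eq_mul, Finset.mul_sum]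
    refine Finset.sum_congr rfl fun u' _ => ?_
    split_ifs
    · exact congrFun hMR u'
    · simp
  have hxR := (hM.eq_of_mulVec_eq hr0 hL' hR' hR1' (vecMul_inducedMatrix hp.1 hLM n) hMR' hx0
    hx1 hMx).2
  rw [legalSum, legalSum, ← hxR]
  rw [hdot fun v => g (List.ofFn v.1)]
  simp only [ofFn_legalInit]

theorem IsNondegenerateProb.legalSum_drop (n : ℕ) {g : List A → ℝ} {c : ℝ} (hg : ∀ y, |g y| ≤ c) :
    legalSum (θ.perronVector p (n + 2)) (fun y => g (y.drop 1)) =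
      legalSum (θ.perronVector p (n + 1)) g := by
  have := Fintype.ofFinite A
  rw [← hp.legalSum_take hprim hne n g]
  obtain ⟨hR, hR1, s, hs, -, hMR⟩ := hp.isPerronVector hprim hne (n + 2)
  obtain ⟨L, r, hL, hr, hLM⟩ := hp.exists_weights hprim hne
  set R := θ.perronVector p (n + 2)
  have hsr : s = r := by
    have hLR : 0 < (fun u : θ.LegalWord (n + 2) => L (u.1 0)) ⬝ᵥ R :=
      have := nonempty_legalWord hne (n + 2)
      Finset.sum_pos (fun i _ => mul_pos (hL _) (hR i)) Finset.univ_nonempty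
    exact Matrix.eigenvalue_eq_of_dotProduct_pos hLR (vecMul_inducedMatrix hp.1 hLM (n + 1)) hMR
  subst hsr
  have hbound : ∀ (k : ℕ) (g : List A → ℝ), (∀ y, |g y| ≤ c) →
      s ^ k * |legalSum R (edgeDiff (n + 1) g)| ≤ 2 * c := by
    intro k
    induction k with
    | zero =>
      intro g hg
      rw [pow_zero, one_mul]
      calc |legalSum R (edgeDiff (n + 1) g)| ≤ ∑ u, 2 * c * R u := by
            refine (Finset.abs_sum_le_sum_abs _ _).trans (Finset.sum_le_sum fun u _ => ?_)
            rw [abs_mul, abs_of_pos (hR u)]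
            refine mul_le_mul_of_nonneg_right ?_ (hR u).le
            refine (abs_sub _ _).trans ?_
            linarith [hg ((List.ofFn u.1).drop 1), hg ((List.ofFn u.1).take (n + 1))]
        _ = 2 * c := by rw [← Finset.mul_sum, hR1, mul_one]
    | succ k ih =>
      intro g hg
      have h1 := legalSum_windowExpectation hMR (edgeDiff (n + 1) g)
      have h2 := ih (fun z => θ.imageExpectation p z fun y => g (y.take (n + 1)))
        fun z => θ.abs_imageExpectation_le hp.1 z fun y => hg _
      have h3 : legalSum R (θ.windowExpectation p (n + 2) (edgeDiff (n + 1) g)) =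
          legalSum R (edgeDiff (n + 1)
            fun z => θ.imageExpectation p z fun y => g (y.take (n + 1))) :=
        Finset.sum_congr rfl fun u _ => by
          rw [θ.windowExpectation_edgeDiff hp.1 (by simp)]
      rw [h1] at h3
      rwa [← h3, abs_mul, abs_of_pos hs, ← mul_assoc, ← pow_succ] at h2
  have hzero : legalSum R (edgeDiff (n + 1) g) = 0 := by
    by_contra hcon
    have hpos := abs_pos.2 hcon
    obtain ⟨k, hk⟩ := pow_unbounded_of_one_lt (2 * c / |legalSum R (edgeDiff (n + 1) g)|) hr
    rw [div_lt_iff₀ hpos] at hk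
    exact absurd (hbound k g hg) (not_le.2 hk)
  rw [← sub_eq_zero, ← hzero]
  simp only [legalSum, edgeDiff, sub_mul, Finset.sum_sub_distrib]

theorem IsNondegenerateProb.legalSum_window {m N i : ℕ} (h : i + m ≤ N) {g : List A → ℝ} {c : ℝ}
    (hg : ∀ y, |g y| ≤ c) :
    legalSum (θ.perronVector p (N + 1)) (fun y => g ((y.drop i).take (m + 1))) =
      legalSum (θ.perronVector p (m + 1)) g := by
  induction N generalizing i with
  | zero =>
    obtain rfl : i = 0 := by omega
    obtain rfl : m = 0 := by omega
    refine Finset.sum_congr rfl fun u _ => ?_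
    simp only
    rw [List.drop_zero, List.take_of_length_le (by simp)]
  | succ N ih =>
    obtain _ | i := i
    · obtain hm | hm := Nat.lt_or_ge m (N + 1)
      · rw [← ih (i := 0) (by omega), ← hp.legalSum_take hprim hne N]
        simp [List.take_take, show m ≤ N by omega]
      · obtain rfl : m = N + 1 := by omega
        refine Finset.sum_congr rfl fun u _ => ?_
        simp only
        rw [List.drop_zero, List.take_of_length_le (by simp)]
    · rw [← ih (i := i) (by omega), ← hp.legalSum_drop hprim hne N fun y => hg _]
      simp

end

end RandomSubstitution

namespace RandomSubstitution

open Filter Topology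

variable {A : Type u} [Finite A] [MeasurableSpace A] [DiscreteMeasurableSpace A]

/-- The set of all bi-infinite sequences that show the word `x` at position `k`. -/
def fullCylinder {ℓ : ℕ} (k : ℤ) (x : Fin ℓ → A) : Set (ℤ → A) :=
  {w | ∀ j : Fin ℓ, w (k + (j : ℤ)) = x j}

theorem fullCylinder_eq_iInter {ℓ : ℕ} (k : ℤ) (x : Fin ℓ → A) :
    fullCylinder k x = ⋂ j : Fin ℓ, (fun w : ℤ → A => w (k + (j : ℤ))) ⁻¹' {x j} := by
  ext w
  simp [fullCylinder]

theorem measurableSet_fullCylinder {ℓ : ℕ} (k : ℤ) (x : Fin ℓ → A) :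
    MeasurableSet (fullCylinder k x) := by
  rw [fullCylinder_eq_iInter]
  exact MeasurableSet.iInter fun j => (measurable_pi_apply _) (MeasurableSet.of_discrete)

/-- A limit point of a sequence of probability measures on the sequences over a finite alphabet,
which inherits all eventually constant values on cylinder sets. -/
theorem exists_isProbabilityMeasure_of_eventually (P : ℕ → ProbabilityMeasure (ℤ → A)) :
    ∃ μ : Measure (ℤ → A), IsProbabilityMeasure μ ∧
      ∀ {ℓ : ℕ} (k : ℤ) (x : Fin ℓ → A) (c : ENNReal),
        (∀ᶠ n in atTop, (P n : Measure (ℤ → A)) (fullCylinder k x) = c) →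
          μ (fullCylinder k x) = c := by
  let : TopologicalSpace A := ⊥
  have : DiscreteTopology A := ⟨rfl⟩
  obtain ⟨μ, -, hμ⟩ := isCompact_univ.ultrafilter_le_nhds ((hyperfilter ℕ).map P) (by simp)
  refine ⟨μ, inferInstance, fun {ℓ} k x c hc => ?_⟩
  have hclopen : IsClopen (fullCylinder k x) := by
    rw [fullCylinder_eq_iInter]
    exact isClopen_iInter_of_finite fun j =>
      (isClopen_discrete {x j}).preimage (continuous_apply _)
  have hlim : Tendsto P (hyperfilter ℕ : Filter ℕ) (𝓝 μ) := hμ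
  have h1 := ProbabilityMeasure.tendsto_measure_of_null_frontier_of_tendsto' hlim
    (E := fullCylinder k x) (by simp [hclopen.frontier_eq])
  refine tendsto_nhds_unique h1 (tendsto_const_nhds.congr' ?_)
  have := Nat.hyperfilter_le_atTop hc
  filter_upwards [this] with n hn using hn.symm

variable {θ : RandomSubstitution.{u, v} A}

theorem cylinder_eq_preimage {ℓ : ℕ} (k : ℤ) (x : Fin ℓ → A) :
    θ.cylinder k x = Subtype.val ⁻¹' fullCylinder k x := rfl

theorem measurableSet_cylinder {ℓ : ℕ} (k : ℤ) (x : Fin ℓ → A) : MeasurableSet (θ.cylinder k x) :=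
  measurable_subtype_coe (measurableSet_fullCylinder k x)

theorem cylinder_eq_empty {ℓ : ℕ} (k : ℤ) {x : Fin ℓ → A} (hx : ¬ θ.Legal (List.ofFn x)) :
    θ.cylinder k x = ∅ := by
  refine Set.eq_empty_of_forall_notMem fun w hw => hx ?_
  have := w.2 k ℓ
  rwa [show (fun j : Fin ℓ => w.1 (k + (j : ℤ))) = x from funext hw] at this

theorem measurableSet_subshift (θ : RandomSubstitution.{u, v} A) : MeasurableSet θ.subshift := by
  have e : θ.subshift = ⋂ (k : ℤ) (n : ℕ),
      ⋃ x ∈ {x : Fin n → A | θ.Legal (List.ofFn x)}, fullCylinder k x := by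
    ext w
    simp only [subshift, Set.mem_ofPred_eq, Set.mem_iInter, Set.mem_iUnion]
    refine forall₂_congr fun k n => ⟨fun h => ⟨_, h, fun j => rfl⟩, ?_⟩
    rintro ⟨x, hx, hw⟩
    rwa [show (fun j : Fin n => w (k + (j : ℤ))) = x from funext hw]
  rw [e]
  exact .iInter fun k => .iInter fun n =>
    .biUnion (Set.to_countable _) fun x _ => measurableSet_fullCylinder k x

/-- The cylinder sets of words of odd length that are centred at the origin. -/
def centeredCylinders (θ : RandomSubstitution.{u, v} A) : Set (Set θ.subshift) :=
  {s | ∃ (n : ℕ) (x : Fin (2 * n + 1) → A), s = θ.cylinder (-n) x}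

theorem isPiSystem_centeredCylinders : IsPiSystem θ.centeredCylinders := by
  have key : ∀ (m n : ℕ) (x : Fin (2 * m + 1) → A) (y : Fin (2 * n + 1) → A), m ≤ n →
      (θ.cylinder (-m) x ∩ θ.cylinder (-n) y).Nonempty →
        θ.cylinder (-n) y ⊆ θ.cylinder (-m) x := by
    rintro m n x y hmn ⟨w, hwx, hwy⟩ w' hw' j
    have hj := j.2
    have h1 := hwy ⟨j + (n - m), by omega⟩
    have h2 := hw' ⟨j + (n - m), by omega⟩
    have e : (-(n : ℤ)) + (((j : ℕ) + (n - m) : ℕ) : ℤ) = -(m : ℤ) + (j : ℤ) := by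
      rw [Nat.cast_add, Nat.cast_sub hmn]
      ring
    simp only [e] at h1 h2
    rw [h2, ← h1]
    exact hwx j
  rintro _ ⟨m, x, rfl⟩ _ ⟨n, y, rfl⟩ hne
  rcases le_total m n with h | h
  · exact ⟨n, y, Set.inter_eq_right.2 (key m n x y h hne)⟩
  · exact ⟨m, x, Set.inter_eq_left.2 (key n m y x h (by rwa [Set.inter_comm]))⟩

theorem generateFrom_centeredCylinders :
    (inferInstance : MeasurableSpace θ.subshift) =
      MeasurableSpace.generateFrom θ.centeredCylinders := by
  refine le_antisymm ?_ (MeasurableSpace.generateFrom_le ?_)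
  · refine Measurable.comap_le (m₁ := MeasurableSpace.generateFrom θ.centeredCylinders) ?_
    refine @measurable_pi_lambda _ _ _ (MeasurableSpace.generateFrom θ.centeredCylinders) _ _
      fun i => ?_
    refine @measurable_to_countable' _ _ _ _ (MeasurableSpace.generateFrom θ.centeredCylinders) _
      fun a => ?_
    have hi : 0 ≤ i + i.natAbs ∧ (i + i.natAbs).toNat < 2 * i.natAbs + 1 := by omega
    have e : (fun w : θ.subshift => w.1 i) ⁻¹' {a} =
        ⋃ x ∈ {x : Fin (2 * i.natAbs + 1) → A | x ⟨(i + i.natAbs).toNat, hi.2⟩ = a},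
          θ.cylinder (-(i.natAbs : ℕ)) x := by
      have e1 : -(i.natAbs : ℤ) + ((i + i.natAbs).toNat : ℤ) = i := by
        rw [Int.toNat_of_nonneg hi.1]
        ring
      ext w
      simp only [Set.mem_preimage, Set.mem_singleton_iff, Set.mem_iUnion, Set.mem_ofPred_eq]
      constructor
      · intro h
        refine ⟨fun j => w.1 (-(i.natAbs : ℕ) + (j : ℤ)), ?_, fun j => rfl⟩
        simpa only [Set.mem_ofPred_eq, e1] using h
      · rintro ⟨x, hx, hw⟩
        have := hw ⟨(i + i.natAbs).toNat, hi.2⟩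
        simp only [e1] at this
        rw [this]
        exact hx
    rw [e]
    exact .biUnion (Set.to_countable _) fun x _ =>
      MeasurableSpace.measurableSet_generateFrom ⟨_, x, rfl⟩
  · rintro _ ⟨n, x, rfl⟩
    exact measurableSet_cylinder _ _

theorem ext_of_cylinder {μ ν : Measure θ.subshift} [IsProbabilityMeasure μ]
    [IsProbabilityMeasure ν]
    (h : ∀ (n : ℕ) (k : ℤ) (x : θ.LegalWord (n + 1)), μ (θ.cylinder k x.1) = ν (θ.cylinder k x.1)) :
    μ = ν := by
  refine ext_of_generate_finite _ generateFrom_centeredCylinders isPiSystem_centeredCylinders ?_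
    (by simp)
  rintro _ ⟨n, x, rfl⟩
  by_cases hx : θ.Legal (List.ofFn x)
  · exact h (2 * n) _ ⟨x, hx⟩
  · simp [cylinder_eq_empty _ hx]

theorem sum_measure_cylinder (μ : Measure θ.subshift) (ℓ : ℕ) (k : ℤ) :
    ∑ x : θ.LegalWord ℓ, μ (θ.cylinder k x.1) = μ Set.univ := by
  rw [← tsum_fintype (L := .unconditional _), ← measure_iUnion]
  · congr 1
    refine Set.eq_univ_of_forall fun w => Set.mem_iUnion.2 ⟨⟨_, w.2 k ℓ⟩, fun j => rfl⟩
  · intro x y hxy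
    refine Set.disjoint_left.2 fun w hw hw' => hxy (Subtype.ext (funext fun j => ?_))
    rw [← hw j, ← hw' j]
  · exact fun x => measurableSet_cylinder _ _

theorem measurable_shift : Measurable θ.shift :=
  Measurable.subtype_mk (f := fun (w : θ.subshift) (i : ℤ) => w.1 (i + 1))
    (measurable_pi_lambda _ fun i => (measurable_pi_apply (i + 1)).comp measurable_subtype_coe)

theorem preimage_shift_cylinder {ℓ : ℕ} (k : ℤ) (x : Fin ℓ → A) :
    θ.shift ⁻¹' θ.cylinder k x = θ.cylinder (k + 1) x := by
  ext w
  simp only [cylinder, shift, Set.mem_preimage, Set.mem_ofPred_eq, add_right_comm]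

theorem measure_cylinder_eq_of_measurePreserving {μ : Measure θ.subshift}
    (hμ : MeasurePreserving θ.shift μ μ) {ℓ : ℕ} (k : ℤ) (x : Fin ℓ → A) :
    μ (θ.cylinder k x) = μ (θ.cylinder 0 x) := by
  have h : ∀ k : ℤ, μ (θ.cylinder (k + 1) x) = μ (θ.cylinder k x) := fun k => by
    rw [← preimage_shift_cylinder, hμ.measure_preimage (measurableSet_cylinder _ _).nullMeasurableSet]
  induction k with
  | zero => rfl
  | succ i ih => rw [h, ih]
  | pred i ih => rw [← ih, ← h, sub_add_cancel]

variable [DecidableEq A] {p : θ.Weights}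
variable (hp : θ.IsNondegenerateProb p) (hprim : θ.IsPrimitive) (hne : θ.subshift.Nonempty)
include hp hprim hne

theorem IsNondegenerateProb.isProbabilityMeasure {μ : Measure θ.subshift}
    (hμ : θ.IsFrequencyMeasure p μ) : IsProbabilityMeasure μ := by
  obtain ⟨hR, hR1, -⟩ := hp.isPerronVector hprim hne 1
  refine ⟨?_⟩
  rw [← sum_measure_cylinder μ 1 0]
  simp only [hμ 1]
  rw [← ENNReal.ofReal_sum_of_nonneg fun x _ => (hR x).le, hR1, ENNReal.ofReal_one]

theorem IsNondegenerateProb.eq_of_isFrequencyMeasure {μ ν : Measure θ.subshift}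
    (hμ : θ.IsFrequencyMeasure p μ) (hν : θ.IsFrequencyMeasure p ν) : μ = ν := by
  have := hp.isProbabilityMeasure hprim hne hμ
  have := hp.isProbabilityMeasure hprim hne hν
  exact ext_of_cylinder fun n k x => by rw [hμ (n + 1) x k, hν (n + 1) x k]

theorem IsNondegenerateProb.measurePreserving_shift {μ : Measure θ.subshift}
    (hμ : θ.IsFrequencyMeasure p μ) : MeasurePreserving θ.shift μ μ := by
  refine ⟨measurable_shift, hp.eq_of_isFrequencyMeasure hprim hne (fun ℓ _ x k => ?_) hμ⟩
  rw [Measure.map_apply measurable_shift (measurableSet_cylinder _ _), preimage_shift_cylinder, hμ]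

/-- The sequence that shows the word `u` at position `-n` and the letter `a` elsewhere. -/
def extendWord (a : A) (n : ℕ) (u : Fin (2 * n + 1) → A) : ℤ → A :=
  fun i => if h : (i + n).toNat < 2 * n + 1 then u ⟨(i + n).toNat, h⟩ else a

omit hp hprim hne in
theorem extendWord_mem_fullCylinder (a : A) (n : ℕ) (u : Fin (2 * n + 1) → A) {ℓ : ℕ} (i : ℕ)
    (k : ℤ) (hk : k + n = i) (x : Fin ℓ → A) (h : i + ℓ ≤ 2 * n + 1) :
    extendWord a n u ∈ fullCylinder k x ↔ ((List.ofFn u).drop i).take ℓ = List.ofFn x := by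
  have e : ∀ j : Fin ℓ, (k + (j : ℤ) + n).toNat = i + j := fun j => by omega
  have e2 : ∀ (j : Fin ℓ) (h' : (k + (j : ℤ) + n).toNat < 2 * n + 1),
      u ⟨(k + (j : ℤ) + n).toNat, h'⟩ = u ⟨i + j, by omega⟩ := fun j h' => by
    congr 2
    exact e j
  constructor
  · intro hw
    apply List.ext_getElem
    · simp only [List.length_take, List.length_drop, List.length_ofFn]
      omega
    · intro j h1 h2
      have hj : j < ℓ := by simpa using h2
      have := hw ⟨j, hj⟩
      rw [extendWord, dif_pos (by rw [e ⟨j, hj⟩]; simp only; omega), e2 ⟨j, hj⟩] at this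
      simpa [-List.ofFn_succ] using this
  · intro hw j
    rw [extendWord, dif_pos (by rw [e j]; omega), e2 j]
    have h1 : (j : ℕ) < (((List.ofFn u).drop i).take ℓ).length := by
      simp only [List.length_take, List.length_drop, List.length_ofFn]
      omega
    have h2 := List.getElem_of_eq hw h1
    simpa [-List.ofFn_succ] using h2

theorem IsNondegenerateProb.exists_isFrequencyMeasure :
    ∃ μ, θ.IsFrequencyMeasure p μ := by
  obtain ⟨x₀, -⟩ := id hne
  set R : ∀ n, θ.LegalWord (n + 1) → ℝ := fun n => θ.perronVector p (n + 1)
  have hR : ∀ n u, 0 ≤ R n u := fun n u => ((hp.isPerronVector hprim hne (n + 1)).1 u).le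
  have hR1 : ∀ n, ∑ u, R n u = 1 := fun n => (hp.isPerronVector hprim hne (n + 1)).2.1
  let P : ℕ → Measure (ℤ → A) := fun n =>
    ∑ u, ENNReal.ofReal (R (2 * n) u) • Measure.dirac (extendWord (x₀ 0) n u.1)
  have hP : ∀ n, IsProbabilityMeasure (P n) := fun n => ⟨by
    simp only [P, Measure.coe_finsetSum, Finset.sum_apply, Measure.smul_apply, measure_univ,
      smul_eq_mul, mul_one]
    rw [← ENNReal.ofReal_sum_of_nonneg fun u _ => hR _ u, hR1, ENNReal.ofReal_one]⟩
  obtain ⟨μ, hμ, hcyl⟩ := exists_isProbabilityMeasure_of_eventually fun n => ⟨P n, hP n⟩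
  have hval : ∀ {m : ℕ} (k : ℤ) (x : Fin (m + 1) → A), μ (fullCylinder k x) =
      ENNReal.ofReal (legalSum (R m) fun y => if y = List.ofFn x then 1 else 0) := by
    intro m k x
    refine hcyl k x _ ((eventually_ge_atTop (k.natAbs + m)).mono fun n hn => ?_)
    obtain ⟨i, hi⟩ : ∃ i : ℕ, k + n = i := ⟨(k + n).toNat, by omega⟩
    rw [← hp.legalSum_window hprim hne (i := i) (N := 2 * n) (by omega) (c := 1)
      (fun y => by split_ifs <;> simp)]
    change P n _ = _
    simp only [P, Measure.coe_finsetSum, Finset.sum_apply, Measure.smul_apply, smul_eq_mul,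
      Measure.dirac_apply' _ (measurableSet_fullCylinder k x), legalSum]
    rw [ENNReal.ofReal_sum_of_nonneg fun u _ =>
      mul_nonneg (by split_ifs <;> simp) (hR (2 * n) u)]
    refine Finset.sum_congr rfl fun u _ => ?_
    by_cases hu : extendWord (x₀ 0) n u.1 ∈ fullCylinder k x
    · rw [Set.indicator_of_mem hu, if_pos ((extendWord_mem_fullCylinder (x₀ 0) n u.1 i k hi x
        (by omega)).1 hu)]
      simp [R]
    · rw [Set.indicator_of_notMem hu, if_neg fun h => hu
        ((extendWord_mem_fullCylinder (x₀ 0) n u.1 i k hi x (by omega)).2 h)]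
      simp
  have hlegal : ∀ {m : ℕ} (k : ℤ) (x : θ.LegalWord (m + 1)),
      μ (fullCylinder k x.1) = ENNReal.ofReal (R m x) := by
    intro m k x
    rw [hval]
    congr 1
    simp [legalSum, -List.ofFn_succ, List.ofFn_injective.eq_iff, ← Subtype.ext_iff]
  have hillegal : ∀ {m : ℕ} (k : ℤ) (x : Fin (m + 1) → A), ¬ θ.Legal (List.ofFn x) →
      μ (fullCylinder k x) = 0 := by
    intro m k x hx
    rw [hval, legalSum, Finset.sum_eq_zero, ENNReal.ofReal_zero]
    intro u _
    rw [if_neg fun h : List.ofFn u.1 = List.ofFn x => hx (h ▸ u.2), zero_mul]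
  have hX : μ θ.subshiftᶜ = 0 := by
    refine measure_mono_null (t := ⋃ (k : ℤ) (m : ℕ),
      ⋃ x ∈ {x : Fin (m + 1) → A | ¬ θ.Legal (List.ofFn x)}, fullCylinder k x) ?_ ?_
    · intro w hw
      have : ∃ (k : ℤ) (n : ℕ), ¬ θ.Legal (List.ofFn fun j : Fin n => w (k + (j : ℤ))) := by
        by_contra! h
        exact hw h
      obtain ⟨k, n, hkn⟩ := this
      obtain _ | m := n
      · refine absurd ((legal_singleton (x₀ 0)).of_infix ?_) hkn
        simp
      · exact Set.mem_iUnion₂.2 ⟨k, m, Set.mem_iUnion₂.2 ⟨_, hkn, fun j => rfl⟩⟩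
    · refine measure_iUnion_null fun k => measure_iUnion_null fun m =>
        (measure_biUnion_null_iff (Set.to_countable _)).2 fun x hx => hillegal k x hx
  refine ⟨μ.comap Subtype.val, fun ℓ _ x k => ?_⟩
  obtain ⟨n, rfl⟩ := Nat.exists_eq_succ_of_ne_zero (NeZero.ne ℓ)
  rw [comap_subtype_coe_apply θ.measurableSet_subshift, cylinder_eq_preimage,
    Subtype.image_preimage_coe, Set.inter_comm, measure_inter_conull hX]
  exact hlegal k x

theorem IsNondegenerateProb.existsUnique_isFrequencyMeasure :
    ∃! μ, θ.IsFrequencyMeasure p μ := by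
  obtain ⟨μ, hμ⟩ := hp.exists_isFrequencyMeasure hprim hne
  exact ⟨μ, hμ, fun ν hν => hp.eq_of_isFrequencyMeasure hprim hne hν hμ⟩

omit hp in
theorem perronVectorsIndependent_of_uniquelyErgodic (h : UniquelyErgodic θ.shift) :
    θ.PerronVectorsIndependent := by
  intro ℓ _ p p' hp hp'
  obtain ⟨μ, hμ⟩ := hp.exists_isFrequencyMeasure hprim hne
  obtain ⟨μ', hμ'⟩ := hp'.exists_isFrequencyMeasure hprim hne
  obtain rfl : μ = μ' := h.unique
    ⟨hp.isProbabilityMeasure hprim hne hμ, hp.measurePreserving_shift hprim hne hμ⟩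
    ⟨hp'.isProbabilityMeasure hprim hne hμ', hp'.measurePreserving_shift hprim hne hμ'⟩
  funext x
  have h1 := hμ ℓ x 0
  rw [hμ' ℓ x 0, ENNReal.ofReal_eq_ofReal_iff ((hp'.isPerronVector hprim hne ℓ).1 x).le
    ((hp.isPerronVector hprim hne ℓ).1 x).le] at h1
  exact h1.symm

end RandomSubstitution

namespace RandomSubstitution

variable {A : Type u} {θ σ : RandomSubstitution.{u, v} A} {p : θ.Weights}

/-- The substitution that always replaces the letter `a` by its image number `q a`. -/
def deterministic (θ : RandomSubstitution.{u, v} A) (q : ∀ a, θ.Idx a) :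
    RandomSubstitution.{u, v} A where
  Idx _ := PUnit
  fintypeIdx _ := inferInstance
  nonemptyIdx _ := inferInstance
  word a _ := θ.word a (q a)
  word_ne_nil a _ := θ.word_ne_nil a (q a)

open Classical in
/-- The degenerate probability vectors that always choose the image number `q a` of `a`. -/
noncomputable def pureWeights (θ : RandomSubstitution.{u, v} A) (q : ∀ a, θ.Idx a) : θ.Weights :=
  fun a => Pi.single (q a) 1

theorem pureWeights_mem_stdSimplex (q : ∀ a, θ.Idx a) (a : A) :
    θ.pureWeights q a ∈ stdSimplex ℝ (θ.Idx a) := by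
  classical
  exact single_mem_stdSimplex ℝ (q a)

theorem sum_pureWeights_mul (q : ∀ a, θ.Idx a) (a : A) (f : θ.Idx a → ℝ) :
    ∑ i, θ.pureWeights q a i * f i = f (q a) := by
  classical
  simp [pureWeights, Pi.single_apply]

theorem isSupport_deterministic (q : ∀ a, θ.Idx a) :
    θ.IsSupport (θ.pureWeights q) (θ.deterministic q) := by
  classical
  refine ⟨fun a _ => ⟨q a, by simp [pureWeights], rfl⟩, fun a i hi => ⟨⟨⟩, ?_⟩⟩
  have : i = q a := by
    by_contra hne
    exact hi (by simp [pureWeights, hne])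
  rw [this]
  rfl

theorem isImage_deterministic_iff (q : ∀ a, θ.Idx a) {x y : List A} :
    (θ.deterministic q).IsImage x y ↔ y = x.flatMap fun a => θ.word a (q a) := by
  constructor
  · intro h
    induction h with
    | nil => rfl
    | cons a i _ ih => rw [List.flatMap_cons, ← ih]; rfl
  · rintro rfl
    induction x with
    | nil => exact .nil
    | cons a x ih => exact .cons (θ := θ.deterministic q) a ⟨⟩ ih

theorem imageExpectation_pureWeights (q : ∀ a, θ.Idx a) (x : List A) (f : List A → ℝ) :
    θ.imageExpectation (θ.pureWeights q) x f = f (x.flatMap fun a => θ.word a (q a)) := by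
  induction x generalizing f with
  | nil => rfl
  | cons a x ih => simp only [imageExpectation, ih, sum_pureWeights_mul, List.flatMap_cons]

theorem windowExpectation_pureWeights (q : ∀ a, θ.Idx a) (ℓ : ℕ) (f : List A → ℝ) (a : A)
    (x : List A) :
    θ.windowExpectation (θ.pureWeights q) ℓ f (a :: x) =
      ∑ k ∈ Finset.range (θ.word a (q a)).length,
        f ((((a :: x).flatMap fun a => θ.word a (q a)).drop k).take ℓ) := by
  simp only [windowExpectation, imageExpectation_pureWeights, List.flatMap_cons]
  exact sum_pureWeights_mul q a fun i => ∑ k ∈ Finset.range (θ.word a i).length,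
    f (((θ.word a i ++ x.flatMap fun a => θ.word a (q a)).drop k).take ℓ)

theorem vecMul_substMatrix_pureWeights [Fintype A] [DecidableEq A] (q : ∀ a, θ.Idx a) (L : A → ℝ)
    (a : A) : Matrix.vecMul L (θ.substMatrix (θ.pureWeights q)) a =
      ((θ.word a (q a)).map L).sum := by
  rw [← sum_pureWeights_mul q a fun i => ((θ.word a i).map L).sum]
  exact θ.sum_mul_substMatrix _ L a

theorem IsImage.exists_mem {x y : List A} (h : θ.IsImage x y) {a : A} (ha : a ∈ y) :
    ∃ b ∈ x, ∃ q, a ∈ θ.word b q := by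
  induction h with
  | nil => simp at ha
  | cons b q _ ih =>
    rcases List.mem_append.1 ha with ha | ha
    · exact ⟨b, List.mem_cons_self, q, ha⟩
    · obtain ⟨c, hc, hc'⟩ := ih ha
      exact ⟨c, List.mem_cons_of_mem _ hc, hc'⟩

/-- A substitution some image of which contains every letter that `θ` can produce from the same
letter is primitive if `θ` is. -/
theorem IsPrimitive.of_forall_mem (h : θ.IsPrimitive)
    (hσ : ∀ a q, ∀ b ∈ θ.word a q, ∃ i, b ∈ σ.word a i) : σ.IsPrimitive := by
  obtain ⟨k, hk⟩ := h
  refine ⟨k, fun a b => ?_⟩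
  obtain ⟨y, hy, hay⟩ := hk a b
  clear hk
  induction k generalizing y a with
  | zero => exact ⟨y, hy, hay⟩
  | succ k ih =>
    obtain ⟨z, hz, hy⟩ := hy
    obtain ⟨c, hc, q, hq⟩ := hy.exists_mem hay
    obtain ⟨z', hz', hcz'⟩ := ih c z hz hc
    obtain ⟨i, hi⟩ := hσ c q a hq
    obtain ⟨t, ht, hit⟩ := IsRealisation.exists_mem (m := 1)
      (⟨[c], rfl, isImage_singleton c i⟩ : σ.IsRealisation 1 [c] _) hcz'
    exact ⟨t, hz'.trans ht, hit.subset hi⟩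

theorem IsPrimitive.exists_le_length (h : σ.IsPrimitive) (hg : ∃ a i, 2 ≤ (σ.word a i).length)
    (b : A) (m : ℕ) : ∃ k y, σ.IsRealisation k [b] y ∧ m < y.length := by
  obtain ⟨K, hK⟩ := h
  obtain ⟨a, i, hai⟩ := hg
  induction m with
  | zero => exact ⟨0, [b], rfl, by simp⟩
  | succ m ih =>
    obtain ⟨k, y, hy, hm⟩ := ih
    obtain _ | ⟨c, y⟩ := y
    · simp at hm
    obtain ⟨z, hz, haz⟩ := hK a c
    obtain ⟨t, ht, hit⟩ := IsRealisation.exists_mem (m := 1)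
      (⟨[a], rfl, isImage_singleton a i⟩ : σ.IsRealisation 1 [a] _) haz
    obtain ⟨t', ht'⟩ := σ.exists_isRealisation (K + 1) y
    refine ⟨_, _, hy.trans ((hz.trans ht).append ht' : σ.IsRealisation (K + 1) ([c] ++ y) _), ?_⟩
    have h1 := hai.trans hit.length_le
    have h2 := ht'.length_le
    simp only [List.length_cons, List.length_append] at hm ⊢
    omega

section

variable [Finite A] [DecidableEq A]

/-- If the induced matrix of possibly degenerate weights has a positive right eigenvector and the
support of the weights is primitive and grows, then all legal words are legal for the support. -/
theorem IsSupport.legal_of_mulVec_eq (h : θ.IsSupport p σ)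
    (hp : ∀ a, p a ∈ stdSimplex ℝ (θ.Idx a)) (hσ : σ.IsPrimitive)
    (hg : ∃ a i, 2 ≤ (σ.word a i).length) {n : ℕ} {R : θ.LegalWord (n + 1) → ℝ}
    (hR : ∀ u, 0 < R u) {s : ℝ} (hMR : (θ.inducedMatrix p (n + 1)).mulVec R = s • R)
    (w : θ.LegalWord (n + 1)) : σ.Legal (List.ofFn w.1) := by
  classical
  have := Fintype.ofFinite A
  by_contra hw
  have hA : Nonempty A := ⟨w.1 0⟩
  have hp0 : ∀ a q, 0 ≤ p a q := fun a => (hp a).1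
  obtain ⟨L, r, hL, hr, hLM⟩ := h.exists_letter_weights hp hσ hg
  set M := θ.inducedMatrix p (n + 1)
  set L' : θ.LegalWord (n + 1) → ℝ := fun u => L (u.1 0) with hL'
  have hLM' : Matrix.vecMul L' M = r • L' := vecMul_inducedMatrix hp hLM n
  have hLR : 0 < L' ⬝ᵥ R :=
    Finset.sum_pos (fun u _ => mul_pos (hL _) (hR u)) ⟨w, Finset.mem_univ w⟩
  obtain rfl : s = r := Matrix.eigenvalue_eq_of_dotProduct_pos hLR hLM' hMR
  set χ : θ.LegalWord (n + 1) → ℝ := fun u => if σ.Legal (List.ofFn u.1) then 0 else 1 with hχ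
  have hCD : ∀ u w : θ.LegalWord (n + 1), ¬ σ.Legal (List.ofFn u.1) → σ.Legal (List.ofFn w.1) →
      M u w = 0 := by
    intro u w hu hw
    by_contra hne
    obtain ⟨c, hc, huc⟩ := exists_of_inducedMatrix_ne_zero hne
    exact hu (hw.of_isImage (h.isImage_wordImage c hc) huc)
  have hsum : ∑ u, ∑ w, L' u * M u w * R w * (χ w - χ u) = 0 := by
    have h1 : ∑ u, ∑ w, L' u * M u w * R w * χ w = ∑ w, s * (L' w * R w * χ w) := by
      rw [Finset.sum_comm]
      refine Finset.sum_congr rfl fun w _ => ?_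
      have : ∑ u, L' u * M u w = s * L' w := congrFun hLM' w
      rw [← Finset.sum_mul, ← Finset.sum_mul, this]
      ring
    have h2 : ∑ u, ∑ w, L' u * M u w * R w * χ u = ∑ u, s * (L' u * R u * χ u) := by
      refine Finset.sum_congr rfl fun u _ => ?_
      have : ∑ w, M u w * R w = s * R u := congrFun hMR u
      rw [← Finset.sum_mul]
      simp only [mul_assoc]
      rw [← Finset.mul_sum, this]
      ring
    simp only [mul_sub, Finset.sum_sub_distrib, h1, h2, sub_self]
  have hnonneg : ∀ u w, 0 ≤ L' u * M u w * R w * (χ w - χ u) := by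
    intro u w
    have h0 : 0 ≤ L' u * M u w * R w :=
      mul_nonneg (mul_nonneg (hL _).le (inducedMatrix_nonneg hp0 _ _)) (hR w).le
    by_cases hu : σ.Legal (List.ofFn u.1)
    · refine mul_nonneg h0 ?_
      simp only [hχ, if_pos hu]
      split_ifs <;> simp
    · by_cases hw : σ.Legal (List.ofFn w.1)
      · rw [hCD u w hu hw]
        simp
      · simp only [hχ, if_neg hu, if_neg hw, sub_self, mul_zero, le_refl]
  have hDC : ∀ u w : θ.LegalWord (n + 1), σ.Legal (List.ofFn u.1) → ¬ σ.Legal (List.ofFn w.1) →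
      M u w = 0 := by
    intro u w hu hw
    rw [Finset.sum_eq_zero_iff_of_nonneg fun u _ => Finset.sum_nonneg fun w _ => hnonneg u w]
      at hsum
    have h1 := hsum u (Finset.mem_univ u)
    rw [Finset.sum_eq_zero_iff_of_nonneg fun w _ => hnonneg u w] at h1
    have h2 := h1 w (Finset.mem_univ w)
    simp only [hχ, if_pos hu, if_neg hw, sub_zero, mul_one] at h2
    have h3 : L' u ≠ 0 := (hL _).ne'
    simpa [h3, (hR w).ne'] using h2
  have hpow : ∀ (k : ℕ) (u w : θ.LegalWord (n + 1)), σ.Legal (List.ofFn u.1) →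
      ¬ σ.Legal (List.ofFn w.1) → (M ^ k) u w = 0 := by
    intro k
    induction k with
    | zero =>
      intro u w hu hw
      rw [pow_zero, Matrix.one_apply_ne]
      rintro rfl
      exact hw hu
    | succ k ih =>
      intro u w hu hw
      rw [pow_succ', Matrix.mul_apply]
      refine Finset.sum_eq_zero fun v _ => ?_
      by_cases hv : σ.Legal (List.ofFn v.1)
      · rw [ih v w hv hw, mul_zero]
      · rw [hDC u v hu hv, zero_mul]
  obtain ⟨k, y, hy, hyn⟩ := hσ.exists_le_length hg (w.1 0) n
  obtain ⟨x, hx⟩ := exists_ofFn_eq (n := n + 1) (l := y.take (n + 1)) (by simp; omega)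
  have hxy : List.ofFn x <:+: y := hx ▸ (List.take_prefix _ _).isInfix
  have hxσ : σ.Legal (List.ofFn x) := ⟨k, _, y, hy, hxy⟩
  have := h.inducedMatrix_pow_pos hp0 (u := ⟨x, h.legal hxσ⟩) (w := w) hy hxy
  exact this.ne' (hpow k _ _ hxσ hw)

theorem IsNondegenerateProb.exists_mulVec_eq (hp : θ.IsNondegenerateProb p)
    (hprim : θ.IsPrimitive) (hne : θ.subshift.Nonempty) (hind : θ.PerronVectorsIndependent)
    {p' : θ.Weights} (hp' : ∀ a, p' a ∈ stdSimplex ℝ (θ.Idx a)) (ℓ : ℕ) [NeZero ℓ] :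
    ∃ s : ℝ, (θ.inducedMatrix p' ℓ).mulVec (θ.perronVector p ℓ) = s • θ.perronVector p ℓ := by
  set R := θ.perronVector p ℓ with hRdef
  let P : ℝ → θ.Weights := fun t a i => (1 - t) * p' a i + t * p a i
  have hP : ∀ t, 0 < t → t ≤ 1 → θ.IsNondegenerateProb (P t) := by
    intro t ht ht1
    have hpos : ∀ a i, 0 < P t a i := fun a i =>
      add_pos_of_nonneg_of_pos (mul_nonneg (sub_nonneg.2 ht1) ((hp' a).1 i))
        (mul_pos ht (hp.pos a i))
    refine ⟨fun a => ⟨fun i => (hpos a i).le, ?_⟩, fun a i => (hpos a i).ne'⟩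
    simp only [P, Finset.sum_add_distrib, ← Finset.mul_sum, (hp' a).2, (hp.1 a).2]
    ring
  have hcont : ∀ u w, Continuous fun t => θ.inducedMatrix (P t) ℓ u w := by
    intro u w
    simp only [inducedMatrix, substMatrix, Matrix.of_apply, inducedWeights, P]
    fun_prop
  have hcontR : ∀ u, Continuous fun t => (θ.inducedMatrix (P t) ℓ).mulVec R u := fun u =>
    continuous_finsetSum _ fun w _ => (hcont u w).mul continuous_const
  have hclosed : IsClosed {t : ℝ | ∀ u, (θ.inducedMatrix (P t) ℓ).mulVec R u =
      (∑ u', (θ.inducedMatrix (P t) ℓ).mulVec R u') * R u} := by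
    have e : {t : ℝ | ∀ u, (θ.inducedMatrix (P t) ℓ).mulVec R u =
      (∑ u', (θ.inducedMatrix (P t) ℓ).mulVec R u') * R u} =
      ⋂ u, {t : ℝ | (θ.inducedMatrix (P t) ℓ).mulVec R u =
      (∑ u', (θ.inducedMatrix (P t) ℓ).mulVec R u') * R u} := by ext; simp
    rw [e]
    exact isClosed_iInter fun u => isClosed_eq (hcontR u)
      ((continuous_finsetSum _ fun u' _ => hcontR u').mul continuous_const)
  have hsub : Set.Ioc (0 : ℝ) 1 ⊆ {t : ℝ | ∀ u, (θ.inducedMatrix (P t) ℓ).mulVec R u =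
      (∑ u', (θ.inducedMatrix (P t) ℓ).mulVec R u') * R u} := by
    rintro t ⟨ht, ht1⟩ u
    obtain ⟨-, hR1, s, -, -, hMR⟩ := (hP t ht ht1).isPerronVector hprim hne ℓ
    rw [hind ℓ (P t) p (hP t ht ht1) hp, ← hRdef] at hMR hR1
    rw [hMR]
    simp only [Pi.smul_apply, smul_eq_mul, ← Finset.mul_sum, hR1, mul_one]
  have h0 : (0 : ℝ) ∈ closure (Set.Ioc (0 : ℝ) 1) := by
    rw [closure_Ioc zero_ne_one]
    simp
  have h1 := hclosed.closure_subset_iff.2 hsub h0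
  have hP0 : P 0 = p' := by
    funext a i
    simp [P]
  simp only [Set.mem_ofPred_eq, hP0] at h1
  exact ⟨_, funext h1⟩

/-- If the Perron–Frobenius vectors do not depend on the probabilities, then the longest image of a
letter contains all letters that occur in images of this letter. -/
theorem PerronVectorsIndependent.mem_word (hind : θ.PerronVectorsIndependent)
    (hp : θ.IsNondegenerateProb p) (hprim : θ.IsPrimitive) (hne : θ.subshift.Nonempty)
    (q : ∀ a, θ.Idx a) (hq : ∀ a i, (θ.word a i).length ≤ (θ.word a (q a)).length) (a : A)
    (i : θ.Idx a) {b : A} (hb : b ∈ θ.word a i) : b ∈ θ.word a (q a) := by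
  classical
  have := Fintype.ofFinite A
  obtain ⟨hR, hR1, -⟩ := hp.isPerronVector hprim hne 1
  set R : θ.LegalWord (0 + 1) → ℝ := θ.perronVector p 1
  have key : ∀ q : ∀ a, θ.Idx a, ∃ s : ℝ, ∀ f : A → ℝ,
      ∑ u : θ.LegalWord (0 + 1), ((θ.word (u.1 0) (q (u.1 0))).map f).sum * R u =
        s * ∑ u, f (u.1 0) * R u := by
    intro q
    obtain ⟨s, hs⟩ := hp.exists_mulVec_eq hprim hne hind (pureWeights_mem_stdSimplex q) 1
    refine ⟨s, fun f => ?_⟩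
    have := legalSum_windowExpectation (n := 0) hs (headWeight f)
    simp only [legalSum, List.ofFn_succ] at this
    simp only [θ.windowExpectation_headWeight (pureWeights_mem_stdSimplex q),
      vecMul_substMatrix_pureWeights] at this
    exact this
  obtain ⟨s, hs⟩ := key q
  obtain ⟨s', hs'⟩ := key (Function.update q a i)
  set ua : θ.LegalWord (0 + 1) := ⟨fun _ => a, legal_singleton a⟩
  have hdiff : ∀ f : A → ℝ, (((θ.word a (q a)).map f).sum - ((θ.word a i).map f).sum) * R ua =
      (s - s') * ∑ u, f (u.1 0) * R u := by
    intro f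
    rw [sub_mul s, ← hs, ← hs', ← Finset.sum_sub_distrib, Finset.sum_eq_single ua]
    · simp [ua, sub_mul]
    · intro u _ hu
      have : u.1 0 ≠ a := by
        rintro rfl
        refine hu (Subtype.ext (funext fun j => ?_))
        rw [Fin.fin_one_eq_zero j]
      rw [Function.update_of_ne this, sub_self]
    · simp
  have h1 := hdiff fun _ => 1
  have hR1' : ∑ u, R u = 1 := hR1
  simp only [List.map_const', List.sum_replicate, nsmul_eq_mul, mul_one, one_mul, hR1'] at h1
  have h2 : 0 ≤ s - s' := by
    rw [← h1]
    exact mul_nonneg (sub_nonneg.2 (by exact_mod_cast hq a i)) (hR ua).le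
  have h3 := hdiff fun c => if c = b then 1 else 0
  have h4 : ∀ l : List A, (l.map fun c => if c = b then (1 : ℝ) else 0).sum = l.count b := by
    intro l
    induction l with
    | nil => simp
    | cons c l ih => simp [List.count_cons, ih, add_comm]
  rw [h4, h4] at h3
  have h5 : 0 ≤ ((θ.word a (q a)).count b : ℝ) - (θ.word a i).count b := by
    refine nonneg_of_mul_nonneg_left (?_ : 0 ≤ _ * R ua) (hR ua)
    rw [h3]
    exact mul_nonneg h2 (Finset.sum_nonneg fun u _ =>
      mul_nonneg (by split_ifs <;> simp) (hR u).le)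
  rw [sub_nonneg, Nat.cast_le] at h5
  exact List.count_pos_iff.1 ((List.count_pos_iff.2 hb).trans_le h5)

end

end RandomSubstitution

namespace RandomSubstitution

variable {A : Type u} {θ : RandomSubstitution.{u, v} A}

/-- The sum of `f` over the subwords of length `n` of `z` at all positions, which are truncated at
the end of `z`. -/
def windowSum (n : ℕ) (f : List A → ℝ) (z : List A) : ℝ :=
  ∑ k ∈ Finset.range z.length, f ((z.drop k).take n)

theorem windowSum_append (n : ℕ) (f : List A → ℝ) (s y : List A) :
    windowSum n f (s ++ y) =
      ∑ k ∈ Finset.range s.length, f (((s ++ y).drop k).take n) + windowSum n f y := by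
  rw [windowSum, List.length_append, Finset.sum_range_add]
  congr 1
  refine Finset.sum_congr rfl fun k _ => ?_
  rw [List.drop_append, List.drop_eq_nil_of_le (Nat.le_add_right _ _), Nat.add_sub_cancel_left,
    List.nil_append]

theorem windowSum_cons (n : ℕ) (f : List A → ℝ) (a : A) (z : List A) :
    windowSum n f (a :: z) = f ((a :: z).take n) + windowSum n f z := by
  have := windowSum_append n f [a] z
  simpa using this

theorem abs_sum_range_le {f : ℕ → ℝ} {c : ℝ} (hf : ∀ k, |f k| ≤ c) (n : ℕ) :
    |∑ k ∈ Finset.range n, f k| ≤ n * c := by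
  refine (Finset.abs_sum_le_sum_abs _ _).trans ((Finset.sum_le_sum fun k _ => hf k).trans ?_)
  simp

theorem abs_windowSum_le {f : List A → ℝ} {c : ℝ} (hf : ∀ y, |f y| ≤ c) (n : ℕ) (z : List A) :
    |windowSum n f z| ≤ z.length * c :=
  abs_sum_range_le (fun _ => hf _) _

theorem abs_windowSum_append_sub_right {f : List A → ℝ} {c : ℝ} (hf : ∀ y, |f y| ≤ c) (n : ℕ)
    (s y : List A) : |windowSum n f (s ++ y) - windowSum n f y| ≤ s.length * c := by
  rw [windowSum_append, add_sub_cancel_right]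
  exact abs_sum_range_le (fun _ => hf _) _

theorem abs_windowSum_append_sub_left {f : List A → ℝ} {c : ℝ} (hf : ∀ y, |f y| ≤ c) (n : ℕ)
    (z t : List A) : |windowSum n f (z ++ t) - windowSum n f z| ≤ (2 * n + t.length) * c := by
  have hc : 0 ≤ c := (abs_nonneg _).trans (hf [])
  induction z with
  | nil =>
    have := abs_windowSum_le hf n t
    simp only [List.nil_append, windowSum, List.length_nil, Finset.range_zero, Finset.sum_empty,
      sub_zero] at this ⊢
    refine this.trans (mul_le_mul_of_nonneg_right ?_ hc)
    linarith [(Nat.cast_nonneg n : (0 : ℝ) ≤ n)]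
  | cons a z ih =>
    by_cases hn : n ≤ (a :: z).length
    · rw [List.cons_append, windowSum_cons, windowSum_cons, ← List.cons_append,
        List.take_append_of_le_length hn, add_sub_add_left_eq_sub]
      exact ih
    · have h1 := abs_windowSum_le hf n (a :: z ++ t)
      have h2 := abs_windowSum_le hf n (a :: z)
      rw [List.length_append, Nat.cast_add] at h1
      have h3 : ((a :: z).length : ℝ) ≤ n := by exact_mod_cast (not_le.1 hn).le
      have h4 := mul_le_mul_of_nonneg_right h3 hc
      refine (abs_sub _ _).trans ?_
      nlinarith

theorem windowSum_flatMap (q : ∀ a, θ.Idx a) (n : ℕ) (f : List A → ℝ) (z : List A) :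
    windowSum (n + 1) f (z.flatMap fun a => θ.word a (q a)) =
      windowSum (n + 1) (θ.windowExpectation (θ.pureWeights q) (n + 1) f) z := by
  induction z with
  | nil => rfl
  | cons a z ih =>
    have h1 : θ.windowExpectation (θ.pureWeights q) (n + 1) f ((a :: z).take (n + 1)) =
        θ.windowExpectation (θ.pureWeights q) (n + 1) f (a :: z) := by
      rcases le_total (n + 1) (a :: z).length with h | h
      · conv_rhs => rw [← List.take_append_drop (n + 1) (a :: z)]
        exact (θ.windowExpectation_append (pureWeights_mem_stdSimplex q) (by simp)
          (by simpa using h) _ f).symm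
      · rw [List.take_of_length_le h]
    rw [windowSum_cons, ← ih, h1, windowExpectation_pureWeights, List.flatMap_cons,
      windowSum_append]

theorem exists_prefix_flatMap {h : A → List A} {C : ℕ} (hC : ∀ a, (h a).length ≤ C)
    {w z t : List A} (hw : w.flatMap h = z ++ t) :
    ∃ w' t', w' <+: w ∧ w'.flatMap h = z ++ t' ∧ t'.length ≤ C := by
  induction w generalizing z with
  | nil =>
    obtain ⟨rfl, rfl⟩ := List.append_eq_nil_iff.1 hw.symm
    exact ⟨[], [], List.prefix_rfl, by simp, by simp⟩
  | cons a w ih =>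
    rw [List.flatMap_cons, List.append_eq_append_iff] at hw
    rcases hw with ⟨z', rfl, hz'⟩ | ⟨t', ht', -⟩
    · obtain ⟨w', t', hw', hwz, ht'⟩ := ih hz'
      exact ⟨a :: w', t', List.cons_prefix_cons.2 ⟨rfl, hw'⟩, by simp [hwz], ht'⟩
    · refine ⟨[a], t', ⟨w, rfl⟩, by simp [ht'], ?_⟩
      have := hC a
      rw [ht', List.length_append] at this
      omega

theorem exists_infix_flatMap {h : A → List A} {C : ℕ} (hC : ∀ a, (h a).length ≤ C)
    {w s z t : List A} (hw : w.flatMap h = s ++ (z ++ t)) :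
    ∃ w' s' t', w' <:+: w ∧ w'.flatMap h = s' ++ (z ++ t') ∧ s'.length ≤ C ∧ t'.length ≤ C := by
  induction w generalizing s with
  | nil =>
    obtain ⟨rfl, hzt⟩ := List.append_eq_nil_iff.1 hw.symm
    obtain ⟨rfl, rfl⟩ := List.append_eq_nil_iff.1 hzt
    exact ⟨[], [], [], List.infix_rfl, by simp, by simp, by simp⟩
  | cons a w ih =>
    by_cases hs : s.length ≤ C
    · rw [← List.append_assoc] at hw
      obtain ⟨w', t', hw', hwz, ht'⟩ := exists_prefix_flatMap hC hw
      exact ⟨w', s, t', hw'.isInfix, by rw [hwz, List.append_assoc], hs, ht'⟩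
    · rw [List.flatMap_cons, List.append_eq_append_iff] at hw
      rcases hw with ⟨s', rfl, hs'⟩ | ⟨r, hr, -⟩
      · obtain ⟨w', s'', t', hw', h'⟩ := ih hs'
        exact ⟨w', s'', t', hw'.trans (List.suffix_cons a w).isInfix, h'⟩
      · have := hC a
        rw [hr, List.length_append] at this
        omega

/-- The sums of `f` over all subwords of a legal word are bounded by `β` times the `L`-weight of
the word, up to a constant. -/
def HasWindowBound (θ : RandomSubstitution.{u, v} A) (L : A → ℝ) (n : ℕ) (f : List A → ℝ)
    (β : ℝ) : Prop :=
  ∃ C : ℝ, ∀ z, θ.Legal z → |windowSum (n + 1) f z| ≤ β * (z.map L).sum + C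

theorem hasWindowBound_of_abs_le {L : A → ℝ} (hL : ∀ a, 0 ≤ L a) {n : ℕ} {f : List A → ℝ}
    {β c : ℝ} (hβ : 0 ≤ β) (hf : ∀ y, |f y| ≤ c)
    (h : ∀ u : θ.LegalWord (n + 1), |f (List.ofFn u.1)| ≤ β * L (u.1 0)) :
    θ.HasWindowBound L n f β := by
  have hc : 0 ≤ c := (abs_nonneg _).trans (hf [])
  refine ⟨(n + 1) * c, fun z hz => ?_⟩
  induction z with
  | nil =>
    simp only [windowSum, List.length_nil, Finset.range_zero, Finset.sum_empty, abs_zero,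
      List.map_nil, List.sum_nil, mul_zero, zero_add]
    positivity
  | cons a z ih =>
    by_cases hn : n + 1 ≤ (a :: z).length
    · obtain ⟨x, hx⟩ := exists_ofFn_eq (n := n + 1) (l := (a :: z).take (n + 1)) (by simpa using hn)
      have hleg : θ.Legal (List.ofFn x) := by
        rw [hx]
        exact hz.of_infix (List.take_prefix _ _).isInfix
      have h1 := h ⟨x, hleg⟩
      have hxa : x 0 = a := by
        rw [List.ofFn_succ, List.take_succ_cons] at hx
        exact (List.cons.inj hx).1
      simp only [hx, hxa] at h1
      rw [windowSum_cons, List.map_cons, List.sum_cons, mul_add]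
      have h2 := ih (hz.of_infix (List.suffix_cons a z).isInfix)
      refine (abs_add_le _ _).trans ?_
      linarith
    · refine (abs_windowSum_le hf _ _).trans ?_
      have h3 : ((a :: z).length : ℝ) ≤ n + 1 := by exact_mod_cast (not_le.1 hn).le
      have h4 : 0 ≤ β * ((a :: z).map L).sum :=
        mul_nonneg hβ (List.sum_nonneg (by simpa using ⟨hL a, fun b _ => hL b⟩))
      linarith [mul_le_mul_of_nonneg_right h3 hc]

theorem abs_windowExpectation_pureWeights_le (q : ∀ a, θ.Idx a) {C n : ℕ}
    (hC : ∀ a, (θ.word a (q a)).length ≤ C) {f : List A → ℝ} {c : ℝ} (hf : ∀ y, |f y| ≤ c)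
    (y : List A) : |θ.windowExpectation (θ.pureWeights q) n f y| ≤ C * c := by
  have hc : 0 ≤ c := (abs_nonneg _).trans (hf [])
  cases y with
  | nil =>
    rw [windowExpectation, abs_zero]
    positivity
  | cons a x =>
    rw [windowExpectation_pureWeights]
    exact (abs_sum_range_le (fun _ => hf _) _).trans
      (mul_le_mul_of_nonneg_right (by exact_mod_cast hC a) hc)

theorem sum_map_flatMap {h : A → List A} {L : A → ℝ} {r : ℝ}
    (hL : ∀ a, ((h a).map L).sum = r * L a) (z : List A) :
    ((z.flatMap h).map L).sum = r * (z.map L).sum := by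
  induction z with
  | nil => simp
  | cons a z ih => simp only [List.flatMap_cons, List.map_append, List.sum_append, ih, hL,
      List.map_cons, List.sum_cons, mul_add]

theorem sum_map_le {L : A → ℝ} {Λ : ℝ} (hΛ : ∀ a, L a ≤ Λ) (z : List A) :
    (z.map L).sum ≤ z.length * Λ := by
  induction z with
  | nil => simp
  | cons a z ih =>
    simp only [List.map_cons, List.sum_cons, List.length_cons, Nat.cast_add, Nat.cast_one]
    linarith [hΛ a]

section

variable (q : ∀ a, θ.Idx a) {L : A → ℝ} {r Λ : ℝ} {C : ℕ}
  (hC : ∀ a, (θ.word a (q a)).length ≤ C) (hL : ∀ a, 0 ≤ L a) (hΛ : ∀ a, L a ≤ Λ) (hr : 0 < r)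
  (hLr : ∀ a, ((θ.word a (q a)).map L).sum = r * L a)
  (hdes : ∀ z, θ.Legal z → ∃ w, θ.Legal w ∧ z <:+: w.flatMap fun a => θ.word a (q a))
include hC hL hΛ hr hLr hdes

theorem HasWindowBound.of_windowExpectation {n : ℕ} {f : List A → ℝ} {β c : ℝ} (hβ : 0 ≤ β)
    (hf : ∀ y, |f y| ≤ c)
    (h : θ.HasWindowBound L n (θ.windowExpectation (θ.pureWeights q) (n + 1) f) β) :
    θ.HasWindowBound L n f (β / r) := by
  have hc : 0 ≤ c := (abs_nonneg _).trans (hf [])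
  obtain ⟨K, hK⟩ := h
  refine ⟨C * c + (2 * (n + 1) + C) * c + K + β / r * (2 * C * Λ), fun z hz => ?_⟩
  obtain ⟨w, hw, s, t, hst⟩ := hdes z hz
  rw [List.append_assoc] at hst
  obtain ⟨w', s', t', hw', hst', hs', ht'⟩ := exists_infix_flatMap hC hst.symm
  have h1 := hK w' (hw.of_infix hw')
  rw [← windowSum_flatMap, hst'] at h1
  have h2 := abs_windowSum_append_sub_right hf (n + 1) s' (z ++ t')
  have h3 := abs_windowSum_append_sub_left hf (n + 1) z t'
  have h4 := sum_map_flatMap hLr w'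
  rw [hst', List.map_append, List.sum_append, List.map_append, List.sum_append] at h4
  have hs'' : (s'.length : ℝ) ≤ C := by exact_mod_cast hs'
  have ht'' : (t'.length : ℝ) ≤ C := by exact_mod_cast ht'
  have h5 : β * (w'.map L).sum ≤ β / r * (z.map L).sum + β / r * (2 * C * Λ) := by
    have h6 : β * (w'.map L).sum = β / r * (r * (w'.map L).sum) := by
      field_simp
    rw [h6, ← h4, ← mul_add]
    refine mul_le_mul_of_nonneg_left ?_ (div_nonneg hβ hr.le)
    have h7 : ∀ y : List A, (y.length : ℝ) ≤ C → (y.map L).sum ≤ C * Λ := by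
      intro y hy
      refine (sum_map_le hΛ y).trans ?_
      obtain _ | ⟨a, y⟩ := y
      · rcases isEmpty_or_nonempty A with hA | ⟨⟨a⟩⟩
        · obtain rfl : z = [] := by
            cases z with
            | nil => rfl
            | cons a _ => exact isEmptyElim a
          obtain ⟨-, a, -⟩ := hz
          exact isEmptyElim a
        · simpa using mul_nonneg C.cast_nonneg ((hL a).trans (hΛ a))
      · exact mul_le_mul_of_nonneg_right hy ((hL a).trans (hΛ a))
    linarith [h7 s' hs'', h7 t' ht'']
  have h8 : (s'.length : ℝ) * c ≤ C * c := mul_le_mul_of_nonneg_right hs'' hc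
  have h9 : (2 * ((n + 1 : ℕ) : ℝ) + t'.length) * c ≤ (2 * (n + 1) + C) * c := by
    refine mul_le_mul_of_nonneg_right ?_ hc
    push_cast
    linarith
  have h10 := abs_le.1 h1
  have h11 := abs_le.1 h2
  have h12 := abs_le.1 h3
  rw [abs_le]
  constructor <;> linarith [h10.1, h10.2, h11.1, h11.2, h12.1, h12.2]

theorem HasWindowBound.of_iterate {n : ℕ} (k : ℕ) {f : List A → ℝ} {β c : ℝ} (hβ : 0 ≤ β)
    (hf : ∀ y, |f y| ≤ c)
    (h : θ.HasWindowBound L n ((θ.windowExpectation (θ.pureWeights q) (n + 1))^[k] f) β) :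
    θ.HasWindowBound L n f (β / r ^ k) := by
  induction k generalizing f c with
  | zero => simpa using h
  | succ k ih =>
    rw [pow_succ, ← div_div]
    exact HasWindowBound.of_windowExpectation q hC hL hΛ hr hLr hdes
      (div_nonneg hβ (pow_nonneg hr.le k)) hf
      (ih (abs_windowExpectation_pureWeights_le q hC hf) h)

variable [Finite A] [DecidableEq A]

theorem hasWindowBound_of_legalSum_eq_zero {n : ℕ}
    (hM : (θ.inducedMatrix (θ.pureWeights q) (n + 1)).IsPrimitive) (hL0 : ∀ a, 0 < L a)
    {R : θ.LegalWord (n + 1) → ℝ} (hR : ∀ u, 0 < R u)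
    (hMR : (θ.inducedMatrix (θ.pureWeights q) (n + 1)).mulVec R = r • R) {f : List A → ℝ}
    {c : ℝ} (hf : ∀ y, |f y| ≤ c) (hfR : legalSum R f = 0) {ε : ℝ} (hε : 0 < ε) :
    θ.HasWindowBound L n f ε := by
  have := Fintype.ofFinite A
  have hLM : Matrix.vecMul L (θ.substMatrix (θ.pureWeights q)) = r • L := by
    funext a
    rw [vecMul_substMatrix_pureWeights, hLr]
    rfl
  obtain ⟨k, hk⟩ := hM.exists_abs_vecMul_pow_le hr (fun u => hL0 (u.1 0)) hR
    (vecMul_inducedMatrix (pureWeights_mem_stdSimplex q) hLM n) hMR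
    (f := fun u => f (List.ofFn u.1)) hfR hε
  have hiter : ∀ (k : ℕ) (f : List A → ℝ), Matrix.vecMul (fun u : θ.LegalWord (n + 1) =>
      f (List.ofFn u.1)) (θ.inducedMatrix (θ.pureWeights q) (n + 1) ^ k) = fun u =>
        (θ.windowExpectation (θ.pureWeights q) (n + 1))^[k] f (List.ofFn u.1) := by
    intro k
    induction k with
    | zero => intro f; simp
    | succ k ih =>
      intro f
      rw [pow_succ', ← Matrix.vecMul_vecMul]
      have : Matrix.vecMul (fun u : θ.LegalWord (n + 1) => f (List.ofFn u.1))
          (θ.inducedMatrix (θ.pureWeights q) (n + 1)) = fun u =>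
            θ.windowExpectation (θ.pureWeights q) (n + 1) f (List.ofFn u.1) :=
        funext fun w => θ.sum_mul_inducedMatrix _ f w
      rw [this, ih]
      rfl
  have hbound : ∀ (k : ℕ) (f : List A → ℝ) (c : ℝ), (∀ y, |f y| ≤ c) →
      ∃ c', ∀ y, |(θ.windowExpectation (θ.pureWeights q) (n + 1))^[k] f y| ≤ c' := by
    intro k
    induction k with
    | zero => exact fun f c hf => ⟨c, hf⟩
    | succ k ih =>
      exact fun f c hf => ih _ _ (abs_windowExpectation_pureWeights_le q hC hf)
  obtain ⟨c', hc'⟩ := hbound k f c hf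
  rw [hiter] at hk
  have h1 := HasWindowBound.of_iterate q hC hL hΛ hr hLr hdes k (by positivity) hf
    (hasWindowBound_of_abs_le hL (by positivity) hc' hk)
  rwa [mul_div_cancel_right₀ _ (pow_pos hr k).ne'] at h1

end

/-- A function all whose window sums are small has integral zero for every invariant measure. -/
theorem sum_mul_measure_cylinder_eq_zero [Finite A] [MeasurableSpace A]
    [DiscreteMeasurableSpace A] {L : A → ℝ} {Λ : ℝ} (hL : ∀ a, 0 < L a) (hΛ : ∀ a, L a ≤ Λ)
    {n : ℕ} {f : List A → ℝ} {c : ℝ} (hf : ∀ y, |f y| ≤ c)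
    (h : ∀ ε > 0, θ.HasWindowBound L n f ε) {ν : Measure θ.subshift} [IsProbabilityMeasure ν]
    (hν : MeasurePreserving θ.shift ν ν) :
    ∑ u : θ.LegalWord (n + 1), f (List.ofFn u.1) * ν.real (θ.cylinder 0 u.1) = 0 := by
  set I := ∑ u : θ.LegalWord (n + 1), f (List.ofFn u.1) * ν.real (θ.cylinder 0 u.1) with hI
  have hc : 0 ≤ c := (abs_nonneg _).trans (hf [])
  obtain ⟨x₀⟩ : Nonempty θ.subshift := nonempty_of_isProbabilityMeasure ν
  have hΛ0 : 0 < Λ := (hL (x₀.1 0)).trans_le (hΛ _)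
  let g : ℕ → θ.subshift → ℝ := fun i x => f (List.ofFn fun j : Fin (n + 1) => x.1 (i + (j : ℤ)))
  have hg : ∀ i, g i = fun x => ∑ u : θ.LegalWord (n + 1),
      (θ.cylinder i u.1).indicator (fun _ => f (List.ofFn u.1)) x := by
    intro i
    funext x
    rw [Finset.sum_eq_single ⟨_, x.2 i (n + 1)⟩]
    · exact (Set.indicator_of_mem (s := θ.cylinder i fun j => x.1 (i + (j : ℤ)))
        (fun j => rfl) _).symm
    · intro u _ hu
      refine Set.indicator_of_notMem (fun hx => hu (Subtype.ext (funext fun j => ?_))) _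
      exact (hx j).symm
    · simp
  have hint : ∀ i (u : θ.LegalWord (n + 1)), Integrable
      ((θ.cylinder i u.1).indicator fun _ => f (List.ofFn u.1)) ν := fun i u =>
    (integrable_const _).indicator (measurableSet_cylinder _ _)
  have hgint : ∀ i, Integrable (g i) ν := fun i => by
    rw [hg]
    exact integrable_finsetSum _ fun u _ => hint i u
  have hgI : ∀ i, ∫ x, g i x ∂ν = I := by
    intro i
    rw [hg, integral_finsetSum _ fun u _ => hint i u]
    refine Finset.sum_congr rfl fun u _ => ?_
    rw [integral_indicator_const _ (measurableSet_cylinder _ _), smul_eq_mul, mul_comm,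
      measureReal_def, measure_cylinder_eq_of_measurePreserving hν, ← measureReal_def]
  have hmain : ∀ ε > 0, ∃ K, ∀ N : ℕ, N * |I| ≤ N * (ε * Λ) + K := by
    intro ε hε
    obtain ⟨C, hCb⟩ := h ε hε
    refine ⟨n * (ε * Λ) + C + n * c, fun N => ?_⟩
    have hpt : ∀ x : θ.subshift, |∑ i ∈ Finset.range N, g i x| ≤
        N * (ε * Λ) + (n * (ε * Λ) + C + n * c) := by
      intro x
      set z := List.ofFn fun j : Fin (N + n) => x.1 (0 + (j : ℤ)) with hz
      have h1 := hCb z (x.2 0 (N + n))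
      have h2 : windowSum (n + 1) f z = ∑ i ∈ Finset.range N, g i x +
          ∑ i ∈ Finset.range n, f ((z.drop (N + i)).take (n + 1)) := by
        rw [windowSum, hz, List.length_ofFn, Finset.sum_range_add]
        congr 1
        refine Finset.sum_congr rfl fun i hi => ?_
        have hi := Finset.mem_range.1 hi
        congr 1
        apply List.ext_getElem
        · simp only [List.length_take, List.length_drop, List.length_ofFn]
          omega
        · intro j hj1 hj2
          simp [-List.ofFn_succ]
      have h3 : (z.map L).sum ≤ (N + n) * Λ := by
        refine (sum_map_le hΛ z).trans ?_
        rw [hz, List.length_ofFn, Nat.cast_add]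
      have h4 := abs_sum_range_le (fun i => hf ((z.drop (N + i)).take (n + 1))) n
      have h5 := mul_le_mul_of_nonneg_left h3 hε.le
      rw [h2] at h1
      have h6 := abs_le.1 h1
      have h7 := abs_le.1 h4
      rw [abs_le]
      constructor <;> nlinarith [h6.1, h6.2, h7.1, h7.2]
    have h8 : ∫ x, ∑ i ∈ Finset.range N, g i x ∂ν = N * I := by
      rw [integral_finsetSum _ fun i _ => hgint i]
      simp [hgI]
    have h9 := norm_integral_le_of_norm_le_const (μ := ν)
      (f := fun x => ∑ i ∈ Finset.range N, g i x) (Filter.Eventually.of_forall hpt)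
    rw [h8, Real.norm_eq_abs, abs_mul, Nat.abs_cast] at h9
    simpa using h9
  by_contra hne
  have hpos := abs_pos.2 hne
  obtain ⟨K, hK⟩ := hmain (|I| / (2 * Λ)) (by positivity)
  have e : |I| / (2 * Λ) * Λ = |I| / 2 := by field_simp
  obtain ⟨N, hN⟩ := exists_nat_gt (K / (|I| / 2))
  rw [div_lt_iff₀ (by positivity)] at hN
  have := hK N
  rw [e] at this
  linarith

section

variable [Finite A] [DecidableEq A] [MeasurableSpace A] [DiscreteMeasurableSpace A]
  {p : θ.Weights}

theorem PerronVectorsIndependent.uniquelyErgodic (hind : θ.PerronVectorsIndependent)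
    (hp : θ.IsNondegenerateProb p) (hprim : θ.IsPrimitive) (hne : θ.subshift.Nonempty) :
    UniquelyErgodic θ.shift := by
  classical
  have := Fintype.ofFinite A
  obtain ⟨μ, hμ⟩ := hp.exists_isFrequencyMeasure hprim hne
  obtain ⟨x₀, -⟩ := id hne
  have hA : Nonempty A := ⟨x₀ 0⟩
  choose q hq using fun a => Finite.exists_max fun i : θ.Idx a => (θ.word a i).length
  have hsup := isSupport_deterministic q
  have hstd := pureWeights_mem_stdSimplex q
  have hstd0 : ∀ a i, 0 ≤ θ.pureWeights q a i := fun a => (hstd a).1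
  have hσ : (θ.deterministic q).IsPrimitive := hprim.of_forall_mem fun a i b hb =>
    ⟨⟨⟩, hind.mem_word hp hprim hne q hq a i hb⟩
  have hg : ∃ a i, 2 ≤ ((θ.deterministic q).word a i).length := by
    obtain ⟨a, i, hai⟩ := exists_two_le_length hne
    exact ⟨a, ⟨⟩, hai.trans (hq a i)⟩
  obtain ⟨L, r, hL, hr, hLM⟩ := hsup.exists_letter_weights hstd hσ hg
  have hr0 := zero_lt_one.trans hr
  have hR : ∀ n u, 0 < θ.perronVector p (n + 1) u := fun n u =>
    (hp.isPerronVector hprim hne (n + 1)).1 u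
  have hMR : ∀ n, (θ.inducedMatrix (θ.pureWeights q) (n + 1)).mulVec (θ.perronVector p (n + 1)) =
      r • θ.perronVector p (n + 1) := by
    intro n
    obtain ⟨s, hs⟩ := hp.exists_mulVec_eq hprim hne hind hstd (n + 1)
    obtain ⟨w⟩ := nonempty_legalWord hne (n + 1)
    have hLR : 0 < (fun u : θ.LegalWord (n + 1) => L (u.1 0)) ⬝ᵥ θ.perronVector p (n + 1) :=
      Finset.sum_pos (fun u _ => mul_pos (hL _) (hR n u)) ⟨w, Finset.mem_univ w⟩
    rwa [Matrix.eigenvalue_eq_of_dotProduct_pos hLR (vecMul_inducedMatrix hstd hLM n) hs] at hs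
  have hlegal : ∀ z, θ.Legal z → (θ.deterministic q).Legal z := by
    intro z hz
    obtain _ | ⟨a, z⟩ := z
    · exact (legal_singleton (x₀ 0)).of_infix (List.nil_infix)
    · obtain ⟨x, hx⟩ := exists_ofFn_eq (n := z.length + 1) (l := a :: z) rfl
      rw [← hx] at hz ⊢
      exact hsup.legal_of_mulVec_eq hstd hσ hg (hR _) (hMR _) ⟨x, hz⟩
  have hdes : ∀ z, θ.Legal z → ∃ w, θ.Legal w ∧ z <:+: w.flatMap fun a => θ.word a (q a) := by
    intro z hz
    obtain _ | ⟨a, z⟩ := z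
    · exact ⟨_, legal_singleton (x₀ 0), List.nil_infix⟩
    · obtain ⟨x, hx⟩ := exists_ofFn_eq (n := z.length + 1) (l := a :: z) rfl
      rw [← hx] at hz ⊢
      have h1 := congrFun (hMR z.length) ⟨x, hz⟩
      have h2 : (r • θ.perronVector p (z.length + 1)) ⟨x, hz⟩ ≠ 0 :=
        (mul_pos hr0 (hR _ _)).ne'
      rw [← h1] at h2
      obtain ⟨w, -, hw⟩ := Finset.exists_ne_zero_of_sum_ne_zero h2
      obtain ⟨c, hc, hzc⟩ := exists_of_inducedMatrix_ne_zero (left_ne_zero_of_mul hw)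
      refine ⟨_, w.2, ?_⟩
      rwa [← (isImage_deterministic_iff q).1 (hsup.isImage_wordImage c hc)]
  obtain ⟨a₁, ha₁⟩ := Finite.exists_max L
  obtain ⟨a₂, ha₂⟩ := Finite.exists_max fun a => (θ.word a (q a)).length
  refine ⟨μ, ⟨hp.isProbabilityMeasure hprim hne hμ, hp.measurePreserving_shift hprim hne hμ⟩, ?_⟩
  rintro ν ⟨hν1, hν⟩
  refine hp.eq_of_isFrequencyMeasure hprim hne (fun ℓ _ x k => ?_) hμ
  obtain ⟨n, rfl⟩ := Nat.exists_eq_succ_of_ne_zero (NeZero.ne ℓ)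
  have hνR : (fun u : θ.LegalWord (n + 1) => ν.real (θ.cylinder 0 u.1)) =
      θ.perronVector p (n + 1) := by
    refine Matrix.eq_of_dotProduct_eq_zero ?_ (hp.isPerronVector hprim hne (n + 1)).2.1 ?_
    · have h1 := sum_measure_cylinder ν (n + 1) 0
      rw [measure_univ] at h1
      simp only [measureReal_def]
      rw [← ENNReal.toReal_sum fun u _ => measure_ne_top _ _, h1, ENNReal.toReal_one]
    · intro f hf
      set F : List A → ℝ := fun y => ∑ u : θ.LegalWord (n + 1), if List.ofFn u.1 = y then f u else 0
      have hF : ∀ u : θ.LegalWord (n + 1), F (List.ofFn u.1) = f u := by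
        intro u
        simp only [F, List.ofFn_injective.eq_iff, ← Subtype.ext_iff, Finset.sum_ite_eq',
          Finset.mem_univ, if_true]
      have hFb : ∀ y, |F y| ≤ ∑ u, |f u| := fun y =>
        (Finset.abs_sum_le_sum_abs _ _).trans (Finset.sum_le_sum fun u _ => by
          split_ifs <;> simp)
      have hFR : legalSum (θ.perronVector p (n + 1)) F = 0 := by
        simp only [legalSum, hF]
        exact hf
      have h1 := sum_mul_measure_cylinder_eq_zero hL ha₁ hFb (fun ε hε =>
        hasWindowBound_of_legalSum_eq_zero q ha₂ (fun a => (hL a).le) ha₁ hr0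
          (fun a => by rw [← vecMul_substMatrix_pureWeights, hLM]; rfl) hdes
          (hsup.isPrimitive_inducedMatrix hstd0 hσ hlegal) hL (hR n) (hMR n) hFb hFR hε) hν
      simp only [hF] at h1
      exact h1
  rw [measure_cylinder_eq_of_measurePreserving hν, ← hνR, ofReal_measureReal]

end

end RandomSubstitution

theorem mainTheorem5 {A : Type u} [Finite A] [DecidableEq A] [MeasurableSpace A]
    [DiscreteMeasurableSpace A] (θ : RandomSubstitution.{u, v} A)
    (hprim : θ.IsPrimitive) (hne : θ.subshift.Nonempty) :
    -- the vectors and the measures below are well defined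
    (∀ p : θ.Weights, θ.IsNondegenerateProb p →
      (∀ (ℓ : ℕ) [NeZero ℓ], ∃! R, IsPerronVector (θ.inducedMatrix p ℓ) R) ∧
      ∃! μ, θ.IsFrequencyMeasure p μ) ∧
    -- part (a)
    (UniquelyErgodic θ.shift → θ.PerronVectorsIndependent) ∧
    -- part (b)
    (∀ p : θ.Weights, θ.IsNondegenerateProb p → Ergodic θ.shift (θ.frequencyMeasure p) →
      (UniquelyErgodic θ.shift ↔ θ.PerronVectorsIndependent)) :=
  ⟨fun _ hp => ⟨fun ℓ _ => hp.existsUnique_isPerronVector hprim hne ℓ,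
      hp.existsUnique_isFrequencyMeasure hprim hne⟩,
    RandomSubstitution.perronVectorsIndependent_of_uniquelyErgodic hprim hne,
    fun _ hp _ => ⟨RandomSubstitution.perronVectorsIndependent_of_uniquelyErgodic hprim hne,
      fun hind => hind.uniquelyErgodic hp hprim hne⟩⟩
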